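/- **Setting.** Let $d,n\ge 1$ and let $M^d$ be the space of real symmetric $d\times d$ matrices with the Hilbert–Schmidt product $(A,B)_{HS}={\rm tr}({}^tAB)$; for symmetric matrices, $A\le B$ means that $B-A$ is positive semidefinite. (F1) Let $\nu_0\in(0,1]$ and let $\psi_1,\dots,\psi_n$ be diffeomorphisms of ${\bf R}^d$ of class $C^{1,\nu_0}$ with Lipschitz constants at most $\eta<1$. Let $G$ be the unique nonempty compact set with $G=\bigcup_i\psi_i(G)$, and suppose ${\rm diam}(G)\le 1$ (which is obtained by rescaling the norm). Let $\Sigma=\{1,\dots,n\}^{\bf N}$, with the product topology and the distances $d_\gamma(x,y)=\gamma^{k}$, $k=\inf\{i: x_i\ne y_i\}$, where $\gamma\in(\eta,1)$. Let $\sigma$ be the shift of $\Sigma$ and let $\Phi:\Sigma\to G$ be the coding map, $\{\Phi(x)\}=\bigcap_{l}\psi_{x_0}\circ\dots\circ\psi_{x_l}(G)$. (F2) For $i\ne j$ the set $\psi_i(G)\cap\psi_j(G)$ is finite; put ${\cal F}=\bigcup_{i\neq j}\psi_i(G)\cap\psi_j(G)$. (F3) The set $\bigcup_{j\ge 1}\sigma^j(\Phi^{-1}({\cal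 F}))$ is finite. (F4) There are disjoint open sets ${\cal O}_1,\dots,{\cal O}_n\subset{\bf R}^d$ with $G\cap{\cal O}_i=\psi_i(G)\setminus\bigcup_{j\ne i}(\psi_i(G)\cap\psi_j(G))$ for all $i$. (ND) with constant $b>0$: for all $x\in G$ and $v,v_0\in{\bf R}^d$ there is $i$ with $|(D\psi_i(x)v,v_0)|\ge b\|v\|\,\|v_0\|$. The Ruelle operators are ${\cal L}_G$ on $C(G,M^d)$ and ${\cal L}_\Sigma$ on $C(\Sigma,M^d)$, $$({\cal L}_GA)(x)=\sum_{i=1}^n{}^tD\psi_i(x)\,A_{\psi_i(x)}\,D\psi_i(x),\qquad ({\cal L}_\Sigma A)(x)=\sum_{i=1}^n{}^tD\psi_i|_{\Phi(x)}\,A_{(ix)}\,D\psi_i|_{\Phi(x)},$$ where $(ix)=(i\,x_0x_1\dots)$. On $C(E,M^d)$ we put $\|A\|_\infty=\sup_x\|A_x\|_{HS}$. For a metric space $(E,\hat d)$, $a>0$ and $\nu\in(0,1]$, $C_+(E,a,\nu)$ is the set of the $A\in C(E,M^d)$ with $A_x$ positive definite for all $x$ and $e^{-a\hat d(x,y)^\nu}A_x\le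 A_y\le e^{a\hat d(x,y)^\nu}A_x$ for all $x,y\in E$. For an $M^d$-valued Borel measure $\tau$ on $E$ with polar decomposition $\tau=T\|\tau\|$ put $\int_E(B,d\tau)_{HS}=\int_E(B_x,T_x)_{HS}\,d\|\tau\|(x)$; ${\cal L}^*$ is the adjoint of ${\cal L}$ for this pairing. ${\cal P}_Q(E,M^d)$ is the set of the $M^d$-valued Borel measures $\tau$ with positive semidefinite values and $\int_E(Q,d\tau)_{HS}=1$. **Proposition.** For given $d,n$ there are numbers $a_0(\nu,r)$ ($\nu\in(0,1]$, $r\in[0,1)$) and $\omega(a,b)>0$ ($a,b>0$) such that the following holds whenever (F1)–(F4) and (ND) with constant $b$ hold. Let $(E,\hat d,{\cal L},r)$ be either $(G,|\cdot-\cdot|,{\cal L}_G,\eta)$ or $(\Sigma,d_\gamma,{\cal L}_\Sigma,\gamma)$, let $a>0$ with $a>a_0(\nu_0,r)$, and suppose that $$\|D\psi_i(x)-D\psi_i(y)\|_{HS}\le\omega(a,b)\,\|x-y\|^{\nu_0}\qquad\forall x,y\in G,\ \forall i.$$ 1) There is a simple eigenvalue $\beta>0$ of ${\cal L}:C(E,M^d)\to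 C(E,M^d)$ (that is, $\bigcup_k\ker({\cal L}-\beta)^k$ is one-dimensional), with an eigenfunction $Q\in C_+(E,a,\nu_0)$; in particular $Q_x$ is positive definite for all $x\in E$. If all the $\psi_i$ are affine, $Q$ is a constant matrix. 2) There is $\tau\in{\cal P}_Q(E,M^d)$ with ${\cal L}^*\tau=\beta\tau$, and it is the only element of ${\cal P}_Q(E,M^d)$ with this property. 3) For every $B\in C(E,M^d)$, $\beta^{-l}{\cal L}^lB\to Q\int_E(B,d\tau)_{HS}$ uniformly on $E$ as $l\to\infty$. The convergence is exponentially fast on the Hölder cones: for all $\nu\in(0,\nu_0]$ and $a'>0$ there are $K$ and $q\in(0,1)$ such that $$\Big\|\beta^{-l}{\cal L}^lB-Q\int_E(B,d\tau)_{HS}\Big\|_\infty\le K\,q^l\,\|B\|_\infty\qquad\forall B\in C_+(E,a',\nu),\ \forall l\ge 0.$$ -/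

import Mathlib

open Set Filter Topology MeasureTheory
open scoped NNReal

noncomputable section

/-! ### Symmetric matrices with the Hilbert-Schmidt inner product -/

/-- The Euclidean space `ℝ^d`. -/
abbrev Eucl (d : ℕ) : Type := EuclideanSpace ℝ (Fin d)

/-- The linear subspace of symmetric `d × d` real matrices. -/
def symSubmodule (d : ℕ) : Submodule ℝ (Matrix (Fin d) (Fin d) ℝ) where
  carrier := {A | A.IsSymm}
  add_mem' hA hB := hA.add hB
  zero_mem' := Matrix.isSymm_zero
  smul_mem' c _ hA := hA.smul c

/-- The space `M^d` of symmetric `d × d` real matrices. It is a type synonym of the subspace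
`symSubmodule d`, so that it carries only the norm coming from the Hilbert-Schmidt product. -/
def SymMat (d : ℕ) : Type := symSubmodule d

namespace SymMat

variable {d : ℕ}

instance : AddCommGroup (SymMat d) := inferInstanceAs (AddCommGroup (symSubmodule d))

instance : Module ℝ (SymMat d) := inferInstanceAs (Module ℝ (symSubmodule d))

instance : Module.Finite ℝ (SymMat d) := inferInstanceAs (Module.Finite ℝ (symSubmodule d))

/-- The matrix underlying an element of `M^d`. -/
def mat (A : SymMat d) : Matrix (Fin d) (Fin d) ℝ := Subtype.val A

/-- A symmetric matrix as an element of `M^d`. -/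
def mk (A : Matrix (Fin d) (Fin d) ℝ) (hA : A.IsSymm) : SymMat d := ⟨A, hA⟩

@[simp]
theorem mat_mk (A : Matrix (Fin d) (Fin d) ℝ) (hA : A.IsSymm) : (mk A hA).mat = A := rfl

theorem isSymm (A : SymMat d) : A.mat.IsSymm := Subtype.property A

@[ext]
theorem ext {A B : SymMat d} (h : A.mat = B.mat) : A = B := Subtype.ext h

@[simp]
theorem mat_add (A B : SymMat d) : (A + B).mat = A.mat + B.mat := rfl

@[simp]
theorem mat_smul (c : ℝ) (A : SymMat d) : (c • A).mat = c • A.mat := rfl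

/-- The Hilbert-Schmidt product `(A, B)_HS = tr (ᵗA B)`. -/
abbrev hsCore : InnerProductSpace.Core ℝ (SymMat d) where
  inner A B := (A.mat.transpose * B.mat).trace
  conj_inner_symm A B := by
    have := Matrix.trace_transpose (B.mat.transpose * A.mat)
    simpa [Matrix.transpose_mul] using this.symm
  re_inner_nonneg A := by
    change 0 ≤ (A.mat.transpose * A.mat).trace
    simp only [Matrix.trace, Matrix.diag_apply, Matrix.mul_apply, Matrix.transpose_apply]
    exact Finset.sum_nonneg fun i _ => Finset.sum_nonneg fun j _ => mul_self_nonneg (A.mat j i)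
  add_left A B C := by simp [Matrix.add_mul]
  smul_left A B c := by simp
  definite A h := by
    simp only [Matrix.trace, Matrix.diag_apply, Matrix.mul_apply, Matrix.transpose_apply] at h
    rw [Finset.sum_eq_zero_iff_of_nonneg
      (fun i _ => Finset.sum_nonneg fun j _ => mul_self_nonneg _)] at h
    refine ext (Matrix.ext fun j i => ?_)
    have h1 := h i (Finset.mem_univ _)
    rw [Finset.sum_eq_zero_iff_of_nonneg (fun j _ => mul_self_nonneg _)] at h1
    exact mul_self_eq_zero.1 (h1 j (Finset.mem_univ _))

instance : NormedAddCommGroup (SymMat d) := hsCore.toNormedAddCommGroup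

instance : InnerProductSpace ℝ (SymMat d) := InnerProductSpace.ofCore hsCore.toCore

theorem inner_eq (A B : SymMat d) : inner ℝ A B = (A.mat.transpose * B.mat).trace := rfl

/-- The inclusion of `M^d` in the space of all matrices. -/
def matL : SymMat d →ₗ[ℝ] Matrix (Fin d) (Fin d) ℝ where
  toFun := mat
  map_add' := mat_add
  map_smul' := mat_smul

theorem continuous_mat : Continuous (mat : SymMat d → Matrix (Fin d) (Fin d) ℝ) :=
  matL.continuous_of_finiteDimensional

theorem continuous_of_mat {X : Type*} [TopologicalSpace X] {f : X → SymMat d}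
    (hf : Continuous fun x => (f x).mat) : Continuous f := by
  let g : symSubmodule d →ₗ[ℝ] SymMat d :=
    { toFun := fun A => A, map_add' := fun _ _ => rfl, map_smul' := fun _ _ => rfl }
  have hg : Continuous g := g.continuous_of_finiteDimensional
  exact hg.comp (hf.subtype_mk fun x => (f x).isSymm)

/-- The congruence `A ↦ ᵗP A P`. -/
def congr (P : Matrix (Fin d) (Fin d) ℝ) (A : SymMat d) : SymMat d :=
  mk (P.transpose * A.mat * P) (by
    have h := A.isSymm
    unfold Matrix.IsSymm at h ⊢
    simp [Matrix.transpose_mul, h, Matrix.mul_assoc])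

end SymMat

/-- The Hilbert-Schmidt norm of an arbitrary square matrix. -/
def hsNorm {d : ℕ} (X : Matrix (Fin d) (Fin d) ℝ) : ℝ :=
  Real.sqrt (X.transpose * X).trace

/-! ### Cones of matrix-valued functions, matrix-valued measures, transfer operators -/

section Abstract

variable {d n : ℕ} {E : Type} [TopologicalSpace E]

/-- The cone `C_+(E, a, ν)`, for the distance `δ` on `E`: the continuous fields `A` of
positive-definite matrices with `e^{-a δ(x,y)^ν} A_x ≤ A_y ≤ e^{a δ(x,y)^ν} A_x` for all `x, y`,
where `X ≤ Y` means that `Y - X` is positive semidefinite. -/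
def holderCone (δ : E → E → ℝ) (a ν : ℝ) : Set C(E, SymMat d) :=
  {A | (∀ x, (A x).mat.PosDef) ∧
    ∀ x y, ((A y).mat - Real.exp (-(a * δ x y ^ ν)) • (A x).mat).PosSemidef ∧
      (Real.exp (a * δ x y ^ ν) • (A x).mat - (A y).mat).PosSemidef}

/-- The operator `(L A)(x) = ∑_i ᵗ(D_i(x)) A(s_i(x)) D_i(x)` on `C(E, M^d)`. -/
def transferOp (s : Fin n → C(E, E)) (D : Fin n → C(E, Matrix (Fin d) (Fin d) ℝ)) :
    Module.End ℝ C(E, SymMat d) where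
  toFun A :=
    { toFun := fun x => ∑ i, SymMat.congr (D i x) (A (s i x))
      continuous_toFun := by
        refine continuous_finsetSum _ fun i _ => SymMat.continuous_of_mat ?_
        have h1 : Continuous fun x => D i x := (D i).continuous
        have h2 : Continuous fun x => (A (s i x)).mat :=
          SymMat.continuous_mat.comp (A.continuous.comp (s i).continuous)
        exact (h1.matrix_transpose.matrix_mul h2).matrix_mul h1 }
  map_add' A B := by
    ext1 x
    simp only [ContinuousMap.coe_mk, ContinuousMap.add_apply, ← Finset.sum_add_distrib]
    exact Finset.sum_congr rfl fun i _ =>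
      SymMat.ext (by simp [SymMat.congr, Matrix.mul_add, Matrix.add_mul])
  map_smul' c A := by
    ext1 x
    simp only [ContinuousMap.coe_mk, ContinuousMap.smul_apply, Finset.smul_sum, RingHom.id_apply]
    exact Finset.sum_congr rfl fun i _ => SymMat.ext (by simp [SymMat.congr])

variable [MeasurableSpace E]

/-- The pairing `∫_E (B, dτ)_HS` of a matrix-valued function with a matrix-valued measure. -/
def hsIntegral (B : E → SymMat d) (τ : VectorMeasure E (SymMat d)) : ℝ :=
  τ.integral B (innerSL ℝ)

/-- The set `P_Q(E, M^d)` of the `M^d`-valued Borel measures with positive semidefinite values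
and `∫_E (Q, dτ)_HS = 1`. -/
def PQ (Q : C(E, SymMat d)) : Set (VectorMeasure E (SymMat d)) :=
  {τ | (∀ S : Set E, MeasurableSet S → (τ S).mat.PosSemidef) ∧ hsIntegral Q τ = 1}

/-- `τ' = L^* τ`, where `L^*` is the adjoint of `L` for the duality
`⟨B, τ⟩ = ∫_E (B, dτ)_HS` between `C(E, M^d)` and the `M^d`-valued Borel measures. -/
def IsAdjointImage (L : Module.End ℝ C(E, SymMat d)) (τ τ' : VectorMeasure E (SymMat d)) : Prop :=
  ∀ A : C(E, SymMat d), hsIntegral A τ' = hsIntegral (L A) τ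

/-- The Ruelle-Perron-Frobenius property of an operator `L` on `C(E, M^d)`, for the distance `δ`
and the cone `C_+(E, a, ν₀)`; `aff` is the condition under which the eigenfunction has to be
constant. The norm on `C(E, M^d)` is the supremum of the Hilbert-Schmidt norm. -/
def RuellePerronFrobenius [CompactSpace E] (L : Module.End ℝ C(E, SymMat d)) (δ : E → E → ℝ)
    (a ν₀ : ℝ) (aff : Prop) : Prop :=
  ∃ β : ℝ, 0 < β ∧ ∃ Q ∈ holderCone δ a ν₀,
    -- `β` is a simple eigenvalue, with eigenfunction `Q`
    L.HasEigenvector β Q ∧ L.maxGenEigenspace β = Submodule.span ℝ {Q} ∧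
    (aff → ∃ Q' : SymMat d, ∀ x, Q x = Q') ∧
    ∃ τ ∈ PQ Q,
      IsAdjointImage L τ (β • τ) ∧
      (∀ τ' ∈ PQ Q, IsAdjointImage L τ' (β • τ') → τ' = τ) ∧
      (∀ B : C(E, SymMat d),
        Tendsto (fun l : ℕ => (β ^ l)⁻¹ • (L ^ l) B) atTop (𝓝 (hsIntegral B τ • Q))) ∧
      ∀ ν : ℝ, 0 < ν → ν ≤ ν₀ → ∀ a' : ℝ, 0 < a' →
        ∃ K q : ℝ, 0 < q ∧ q < 1 ∧ ∀ B ∈ holderCone δ a' ν, ∀ l : ℕ,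
          ‖(β ^ l)⁻¹ • (L ^ l) B - hsIntegral B τ • Q‖ ≤ K * q ^ l * ‖B‖

end Abstract

/-! ### Sequences -/

/-- The shift `(x_0 x_1 x_2 …) ↦ (x_1 x_2 …)`. -/
def seqShift {n : ℕ} (x : ℕ → Fin n) : ℕ → Fin n := fun k => x (k + 1)

/-- The sequence `(i x_0 x_1 …)`. -/
def consSeq {n : ℕ} (i : Fin n) (x : ℕ → Fin n) : ℕ → Fin n
  | 0 => i
  | k + 1 => x k

theorem continuous_consSeq {n : ℕ} (i : Fin n) : Continuous (consSeq i) := by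
  refine continuous_pi fun k => ?_
  cases k with
  | zero => exact continuous_const
  | succ k => exact continuous_apply k

open Classical in
/-- The distance `d_γ(x, y) = γ^k`, `k` the first index with `x_k ≠ y_k`, on sequences
(and `0` if `x = y`). -/
def seqDist {n : ℕ} (γ : ℝ) (x y : ℕ → Fin n) : ℝ :=
  if x = y then 0 else γ ^ sInf {k : ℕ | x k ≠ y k}

/-! ### Iterated function systems -/

/-- The Jacobian matrix of `f` at `x`. -/
def jacobian {d : ℕ} (f : Eucl d → Eucl d) (x : Eucl d) : Matrix (Fin d) (Fin d) ℝ :=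
  Matrix.of fun i j => fderiv ℝ f x (EuclideanSpace.single j 1) i

theorem continuous_jacobian {d : ℕ} {f : Eucl d → Eucl d} (hf : ContDiff ℝ 1 f) :
    Continuous (jacobian f) := by
  refine continuous_matrix fun i j => ?_
  have h : Continuous fun x => fderiv ℝ f x (EuclideanSpace.single j 1) :=
    (hf.continuous_fderiv one_ne_zero).clm_apply continuous_const
  exact (EuclideanSpace.proj (𝕜 := ℝ) i).continuous.comp h

/-- Hypothesis (F1): finitely many diffeomorphisms `ψ_i` of `ℝ^d` of class `C^{1,ν₀}`,
`ν₀ ∈ (0, 1]`, with Lipschitz constants at most `η < 1`. -/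
structure ContractiveIFS (d n : ℕ) where
  ψ : Fin n → Eucl d → Eucl d
  ν₀ : ℝ
  ν₀_pos : 0 < ν₀
  ν₀_le_one : ν₀ ≤ 1
  η : ℝ≥0
  η_lt_one : η < 1
  contDiff : ∀ i, ContDiff ℝ 1 (ψ i)
  exists_inverse : ∀ i, ∃ g : Eucl d → Eucl d, ContDiff ℝ 1 g ∧
    Function.LeftInverse g (ψ i) ∧ Function.RightInverse g (ψ i)
  holder : ∃ C : ℝ, ∀ i x y, ‖fderiv ℝ (ψ i) x - fderiv ℝ (ψ i) y‖ ≤ C * dist x y ^ ν₀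
  lipschitz : ∀ i, LipschitzWith η (ψ i)

namespace ContractiveIFS

open TopologicalSpace

variable {d n : ℕ} (S : ContractiveIFS d n)

/-- `ψ_{x_0} ∘ ⋯ ∘ ψ_{x_{l-1}}`. -/
def word (x : ℕ → Fin n) : ℕ → Eucl d → Eucl d
  | 0 => id
  | l + 1 => word x l ∘ S.ψ (x l)

theorem lipschitz_word (x : ℕ → Fin n) (l : ℕ) : LipschitzWith (S.η ^ l) (S.word x l) := by
  induction l with
  | zero => simpa [word] using LipschitzWith.id
  | succ l ih => simpa [word, pow_succ] using ih.comp (S.lipschitz (x l))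

theorem word_congr {x y : ℕ → Fin n} {l : ℕ} (h : ∀ i < l, y i = x i) :
    S.word y l = S.word x l := by
  induction l with
  | zero => rfl
  | succ l ih => simp only [word, h l l.lt_succ_self, ih fun i hi => h i (hi.trans l.lt_succ_self)]

variable [NeZero n]

/-- The map `K ↦ ⋃_i ψ_i(K)` on nonempty compact sets. -/
def hutchinson (K : NonemptyCompacts (Eucl d)) : NonemptyCompacts (Eucl d) where
  carrier := ⋃ i, S.ψ i '' K
  isCompact' := isCompact_iUnion fun i => K.isCompact.image (S.lipschitz i).continuous
  nonempty' := ⟨S.ψ 0 K.nonempty.some, mem_iUnion.2 ⟨0, mem_image_of_mem _ K.nonempty.some_mem⟩⟩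

theorem contracting_hutchinson : ContractingWith S.η S.hutchinson := by
  refine ⟨S.η_lt_one, fun K K' => ?_⟩
  change Metric.hausdorffEDist (⋃ i, S.ψ i '' K) (⋃ i, S.ψ i '' K') ≤
    S.η * Metric.hausdorffEDist (K : Set (Eucl d)) K'
  refine Metric.hausdorffEDist_iUnion_le.trans (iSup_le fun i => ?_)
  have key : ∀ A B : NonemptyCompacts (Eucl d), ∀ y ∈ S.ψ i '' (A : Set (Eucl d)),
      ∃ z ∈ S.ψ i '' (B : Set (Eucl d)),
        edist y z ≤ S.η * Metric.hausdorffEDist (A : Set (Eucl d)) B := by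
    rintro A B _ ⟨x, hx, rfl⟩
    obtain ⟨z, hz, hxz⟩ := B.isCompact.exists_infEDist_eq_edist B.nonempty x
    refine ⟨_, mem_image_of_mem _ hz, (S.lipschitz i x z).trans ?_⟩
    rw [← hxz]
    gcongr
    exact Metric.infEDist_le_hausdorffEDist_of_mem hx
  refine Metric.hausdorffEDist_le_of_mem_edist (key K K') ?_
  intro x hx
  rw [Metric.hausdorffEDist_comm]
  exact key K' K x hx

/-- There is a unique nonempty compact set `G` with `G = ⋃_i ψ_i(G)`. -/
theorem existsUnique_attractor :
    ∃! K : NonemptyCompacts (Eucl d), (K : Set (Eucl d)) = ⋃ i, S.ψ i '' K := by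
  have hc := S.contracting_hutchinson
  have : Nonempty (NonemptyCompacts (Eucl d)) := ⟨⟨⟨{0}, isCompact_singleton⟩, ⟨0, rfl⟩⟩⟩
  refine ⟨hc.fixedPoint, ?_, fun K hK => hc.fixedPoint_unique ?_⟩
  · exact (congrArg (fun K : NonemptyCompacts (Eucl d) => (K : Set (Eucl d)))
      hc.fixedPoint_isFixedPt).symm
  · exact NonemptyCompacts.ext hK.symm

/-- The fractal `G`: the unique nonempty compact set with `G = ⋃_i ψ_i(G)`. -/
def G : Set (Eucl d) := S.existsUnique_attractor.choose

theorem G_eq : S.G = ⋃ i, S.ψ i '' S.G := S.existsUnique_attractor.choose_spec.1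

theorem isCompact_G : IsCompact S.G := NonemptyCompacts.isCompact _

theorem nonempty_G : S.G.Nonempty := NonemptyCompacts.nonempty _

theorem mapsTo_G (i : Fin n) : MapsTo (S.ψ i) S.G S.G := fun x hx => by
  rw [S.G_eq]
  exact mem_iUnion.2 ⟨i, mem_image_of_mem _ hx⟩

instance : CompactSpace S.G := isCompact_iff_compactSpace.1 S.isCompact_G

/-- The cell `ψ_{x_0} ∘ ⋯ ∘ ψ_{x_{l-1}}(G)`. -/
def cell (x : ℕ → Fin n) (l : ℕ) : Set (Eucl d) := S.word x l '' S.G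

theorem cell_succ_subset (x : ℕ → Fin n) (l : ℕ) : S.cell x (l + 1) ⊆ S.cell x l := by
  rintro _ ⟨y, hy, rfl⟩
  exact ⟨S.ψ (x l) y, S.mapsTo_G (x l) hy, rfl⟩

theorem dist_le_of_mem_cell {x : ℕ → Fin n} {l : ℕ} {p q : Eucl d} (hp : p ∈ S.cell x l)
    (hq : q ∈ S.cell x l) : dist p q ≤ (S.η : ℝ) ^ l * Metric.diam S.G := by
  obtain ⟨p, hp, rfl⟩ := hp
  obtain ⟨q, hq, rfl⟩ := hq
  refine ((S.lipschitz_word x l).dist_le_mul p q).trans ?_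
  rw [NNReal.coe_pow]
  gcongr
  exact Metric.dist_le_diam_of_mem S.isCompact_G.isBounded hp hq

theorem tendsto_bound :
    Tendsto (fun l : ℕ => (S.η : ℝ) ^ l * Metric.diam S.G) atTop (𝓝 0) := by
  simpa using (tendsto_pow_atTop_nhds_zero_of_lt_one S.η.2 S.η_lt_one).mul_const (Metric.diam S.G)

/-- The intersection of the cells of a coding is a single point. -/
theorem exists_iInter_cell (x : ℕ → Fin n) : ∃ p, ⋂ l, S.cell x l = {p} := by
  have hne : (⋂ l, S.cell x l).Nonempty :=
    IsCompact.nonempty_iInter_of_sequence_nonempty_isCompact_isClosed _ (S.cell_succ_subset x)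
      (fun l => S.nonempty_G.image _)
      (S.isCompact_G.image (S.lipschitz_word x 0).continuous)
      (fun l => (S.isCompact_G.image (S.lipschitz_word x l).continuous).isClosed)
  obtain ⟨p, hp⟩ := hne
  refine ⟨p, eq_singleton_iff_unique_mem.2 ⟨hp, fun q hq => ?_⟩⟩
  refine dist_le_zero.1 (ge_of_tendsto' S.tendsto_bound fun l => ?_)
  exact S.dist_le_of_mem_cell (mem_iInter.1 hq l) (mem_iInter.1 hp l)

/-- The coding map: `Φ x` is the only point of `⋂_l ψ_{x_0} ∘ ⋯ ∘ ψ_{x_{l-1}}(G)`. -/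
def Φ (x : ℕ → Fin n) : Eucl d := (S.exists_iInter_cell x).choose

theorem iInter_cell (x : ℕ → Fin n) : ⋂ l, S.cell x l = {S.Φ x} :=
  (S.exists_iInter_cell x).choose_spec

theorem Φ_mem_cell (x : ℕ → Fin n) (l : ℕ) : S.Φ x ∈ S.cell x l := by
  have h : S.Φ x ∈ ⋂ l, S.cell x l := by rw [S.iInter_cell]; rfl
  exact mem_iInter.1 h l

theorem continuous_Φ : Continuous S.Φ := by
  refine continuous_iff_continuousAt.2 fun x => Metric.tendsto_nhds.2 fun ε hε => ?_
  obtain ⟨l, hl⟩ := (S.tendsto_bound.eventually_lt_const hε).exists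
  have h : ∀ᶠ y : ℕ → Fin n in 𝓝 x, ∀ i ∈ Finset.range l, y i = x i := by
    refine (Finset.eventually_all _).2 fun i _ => ?_
    exact (continuous_apply i).continuousAt.eventually_mem ((isOpen_discrete {x i}).mem_nhds rfl)
  filter_upwards [h] with y hy
  refine (S.dist_le_of_mem_cell (x := x) (l := l) ?_ (S.Φ_mem_cell x l)).trans_lt hl
  have := S.Φ_mem_cell y l
  rwa [cell, S.word_congr fun i hi => hy i (Finset.mem_range.2 hi)] at this

/-- The set `⋃_{i ≠ j} ψ_i(G) ∩ ψ_j(G)`. -/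
def critical : Set (Eucl d) := ⋃ i, ⋃ j, ⋃ _ : i ≠ j, S.ψ i '' S.G ∩ S.ψ j '' S.G

/-- Hypothesis (F2). -/
def F2 : Prop := ∀ i j, i ≠ j → (S.ψ i '' S.G ∩ S.ψ j '' S.G).Finite

/-- Hypothesis (F3): post-critical finiteness. -/
def F3 : Prop := (⋃ j : ℕ, ⋃ _ : 1 ≤ j, seqShift^[j] '' (S.Φ ⁻¹' S.critical)).Finite

/-- Hypothesis (F4). -/
def F4 : Prop := ∃ O : Fin n → Set (Eucl d), (∀ i, IsOpen (O i)) ∧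
  (∀ i j, i ≠ j → Disjoint (O i) (O j)) ∧
  ∀ i, S.G ∩ O i = S.ψ i '' S.G \ ⋃ j, ⋃ _ : i ≠ j, S.ψ i '' S.G ∩ S.ψ j '' S.G

/-- Hypothesis (ND) with constant `b`. -/
def ND (b : ℝ) : Prop := ∀ x ∈ S.G, ∀ v v₀ : Eucl d, ∃ i,
  b * ‖v‖ * ‖v₀‖ ≤ |inner ℝ (fderiv ℝ (S.ψ i) x v) v₀|

/-- `sup_i ‖Dψ_i‖_{ν₀} ≤ ω`, for the Hölder seminorm of `Dψ_i` on `G`. -/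
def HolderSeminormLE (ω : ℝ) : Prop := ∀ i, ∀ x ∈ S.G, ∀ y ∈ S.G,
  hsNorm (jacobian (S.ψ i) x - jacobian (S.ψ i) y) ≤ ω * dist x y ^ S.ν₀

/-- All the maps `ψ_i` are affine. -/
def IsAffine : Prop := ∀ i, ∃ f : Eucl d →ᵃ[ℝ] Eucl d, ∀ x, S.ψ i x = f x

/-- The Ruelle operator on `C(G, M^d)`,
`(L_G A)(x) = ∑_i ᵗDψ_i(x) A(ψ_i(x)) Dψ_i(x)`. -/
def ruelleG : Module.End ℝ C(S.G, SymMat d) :=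
  transferOp
    (fun i => ⟨(S.mapsTo_G i).restrict, (S.lipschitz i).continuous.restrict (S.mapsTo_G i)⟩)
    (fun i => ⟨fun x => jacobian (S.ψ i) x,
      (continuous_jacobian (S.contDiff i)).comp continuous_subtype_val⟩)

/-- The Ruelle operator on `C(Σ, M^d)`, `Σ = {1, …, n}^ℕ`,
`(L_Σ A)(x) = ∑_i ᵗDψ_i(Φ(x)) A(i x) Dψ_i(Φ(x))`. -/
def ruelleShift : Module.End ℝ C(ℕ → Fin n, SymMat d) :=
  transferOp
    (fun i => ⟨consSeq i, continuous_consSeq i⟩)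
    (fun i => ⟨fun x => jacobian (S.ψ i) (S.Φ x),
      (continuous_jacobian (S.contDiff i)).comp S.continuous_Φ⟩)

end ContractiveIFS

end

/-! Order the continuous fields of symmetric matrices by the closed cone `semiCone` of positive
semidefinite fields with `e^{-aσ} A_x ≤ A_y`, where `σ = dist x y ^ ν`. Nondegeneracy makes the
operator `L` strongly positive on it. A positive semidefinite form is a sum of squares of linear
forms, and each of these is seen by some `D i`, so `∑ i, A (D_i v) ≥ b² ‖A‖ |v|²`
(`SymMat.sum_quad_ge`). As the space has diameter at most 1, this gives `L A ≥ e^{-a} b² ‖A‖ Id`.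
The oscillation of the `D i` only contributes an error of order `ω ‖A‖ σ`, which that lower bound
absorbs, while the contraction of the maps turns `a` into `a r^ν`. So `L` sends the cone into the
one with constant `imageConst`, which is below `a` once `a (1 - r^ν) > 1` and `ω` is small in terms
of `a`, `b`, `n`. This gap places `L A` between `c ‖A‖ Id` and `C ‖A‖ Id` for the order of the cone
(`TransferData.exists_contractsCone`).

These two bounds give a Birkhoff contraction without the Hilbert metric. If `m u ≤ v ≤ M u`, then
one of `v - m u`, `M u - v` has norm at least `(M - m) ‖u‖ / 2`, and applying `L` shortens the
interval `[m, M]` by the factor `1 - c / (2C)` (`ContractsCone.exists_step`). Comparing `L e` with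
`e` in this way yields `β` and `Q`; comparing a Hölder field with `Q` yields exponential convergence
of `β^{-l} L^l` on it.

The normalized iterates are uniformly bounded and Hölder fields are dense, so `β^{-l} L^l B` tends
to `φ(B) Q` for every `B`, with `φ` a positive functional. A Riesz theorem for matrix-valued
measures, obtained by pairing with each positive semidefinite matrix, represents `φ` by `τ`.
Simplicity of `β` and uniqueness of `τ` both follow from the convergence. For an exponent smaller
than `ν₀`, the field is regularized at a scale that shrinks geometrically with `l`. On sequences the
same argument applies because the coding map is 1-Lipschitz for `d_γ`. -/

noncomputable section

/-! ### The Loewner order on symmetric matrices -/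

namespace SymMat

variable {d : ℕ}

/-- The bilinear form `(v, w) ↦ (v, A w)` of a symmetric matrix. -/
def bil (A : SymMat d) (v w : Fin d → ℝ) : ℝ := v ⬝ᵥ A.mat.mulVec w

/-- The quadratic form `v ↦ (v, A v)` of a symmetric matrix. -/
def quad (A : SymMat d) (v : Fin d → ℝ) : ℝ := A.bil v v

theorem bil_comm (A : SymMat d) (v w : Fin d → ℝ) : A.bil v w = A.bil w v := by
  have h : A.mat.transpose = A.mat := A.isSymm
  unfold bil
  rw [Matrix.dotProduct_mulVec, ← Matrix.mulVec_transpose, h, dotProduct_comm]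

@[simp]
theorem mat_sub (A B : SymMat d) : (A - B).mat = A.mat - B.mat := rfl

@[simp]
theorem mat_zero : (0 : SymMat d).mat = 0 := rfl

theorem bil_smul_right (A : SymMat d) (t : ℝ) (v w : Fin d → ℝ) :
    A.bil v (t • w) = t * A.bil v w := by
  simp [bil, Matrix.mulVec_smul]

theorem bil_add_right (A : SymMat d) (v w z : Fin d → ℝ) :
    A.bil v (w + z) = A.bil v w + A.bil v z := by
  simp [bil, Matrix.mulVec_add]

theorem quad_add (A : SymMat d) (v w : Fin d → ℝ) :
    A.quad (v + w) = A.quad v + 2 * A.bil v w + A.quad w := by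
  simp only [quad]
  rw [bil_add_right, bil_comm A (v + w) v, bil_comm A (v + w) w, bil_add_right, bil_add_right,
    bil_comm A w v]
  ring

theorem quad_smul (A : SymMat d) (t : ℝ) (v : Fin d → ℝ) :
    A.quad (t • v) = t ^ 2 * A.quad v := by
  simp only [quad]
  rw [bil_smul_right, bil_comm, bil_smul_right]
  ring

@[simp]
theorem add_quad (A B : SymMat d) (v : Fin d → ℝ) : (A + B).quad v = A.quad v + B.quad v := by
  simp [quad, bil, Matrix.add_mulVec]

@[simp]
theorem sub_quad (A B : SymMat d) (v : Fin d → ℝ) : (A - B).quad v = A.quad v - B.quad v := by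
  simp [quad, bil, Matrix.sub_mulVec]

@[simp]
theorem neg_quad (A : SymMat d) (v : Fin d → ℝ) : (-A).quad v = -A.quad v := by
  have h : (-A).mat = -A.mat := rfl
  simp [quad, bil, h, Matrix.neg_mulVec]

@[simp]
theorem smul_quad (t : ℝ) (A : SymMat d) (v : Fin d → ℝ) : (t • A).quad v = t * A.quad v := by
  simp [quad, bil, Matrix.smul_mulVec]

@[simp]
theorem zero_quad (v : Fin d → ℝ) : (0 : SymMat d).quad v = 0 := by
  simp [quad, bil]

theorem sum_quad {ι : Type*} (s : Finset ι) (A : ι → SymMat d) (v : Fin d → ℝ) :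
    (∑ i ∈ s, A i).quad v = ∑ i ∈ s, (A i).quad v := by
  classical
  induction s using Finset.induction_on with
  | empty => simp
  | insert i s hi ih => simp [Finset.sum_insert hi, ih]

theorem congr_quad (P : Matrix (Fin d) (Fin d) ℝ) (A : SymMat d) (v : Fin d → ℝ) :
    (congr P A).quad v = A.quad (P.mulVec v) := by
  simp only [quad, bil, congr, mat_mk]
  rw [← Matrix.mulVec_mulVec, ← Matrix.mulVec_mulVec, Matrix.dotProduct_mulVec,
    Matrix.vecMul_transpose]

/-- Polarization recovers the bilinear form, and its values on basis vectors are the entries. -/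
theorem ext_quad {A B : SymMat d} (h : ∀ v, A.quad v = B.quad v) : A = B := by
  refine ext (Matrix.ext fun i j => ?_)
  have hb : ∀ v w, A.bil v w = B.bil v w := fun v w => by
    have h1 := h (v + w)
    rw [quad_add, quad_add, h v, h w] at h1
    linarith
  simpa [bil] using hb (Pi.single i 1) (Pi.single j 1)

/-- The Loewner order. -/
instance : PartialOrder (SymMat d) where
  le A B := ∀ v, A.quad v ≤ B.quad v
  le_refl A v := le_rfl
  le_trans A B C h h' v := (h v).trans (h' v)
  le_antisymm A B h h' := ext_quad fun v => (h v).antisymm (h' v)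

theorem le_def {A B : SymMat d} : A ≤ B ↔ ∀ v, A.quad v ≤ B.quad v := Iff.rfl

instance : IsOrderedAddMonoid (SymMat d) where
  add_le_add_left A B h C v := by simpa using h v

instance : PosSMulMono ℝ (SymMat d) where
  smul_le_smul_of_nonneg_left t ht A B h v := by
    simpa using mul_le_mul_of_nonneg_left (h v) ht

theorem nonneg_iff {A : SymMat d} : 0 ≤ A ↔ ∀ v, 0 ≤ A.quad v := by
  simp [le_def]

theorem smul_le_smul_of_le {A : SymMat d} (hA : 0 ≤ A) {s t : ℝ} (h : s ≤ t) : s • A ≤ t • A :=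
  fun v => by simpa using mul_le_mul_of_nonneg_right h (nonneg_iff.1 hA v)

theorem posSemidef_iff {A : SymMat d} : A.mat.PosSemidef ↔ 0 ≤ A := by
  rw [nonneg_iff, Matrix.posSemidef_iff_dotProduct_mulVec]
  refine ⟨fun h v => by simpa [quad, bil] using h.2 v,
    fun h => ⟨?_, fun v => by simpa [quad, bil] using h v⟩⟩
  rw [Matrix.IsHermitian, Matrix.conjTranspose_eq_transpose_of_trivial]
  exact A.isSymm

theorem sub_posSemidef_iff {A B : SymMat d} : (B.mat - A.mat).PosSemidef ↔ A ≤ B := by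
  rw [← mat_sub, posSemidef_iff, sub_nonneg]

theorem posDef_iff {A : SymMat d} : A.mat.PosDef ↔ ∀ v, v ≠ 0 → 0 < A.quad v := by
  rw [Matrix.posDef_iff_dotProduct_mulVec]
  refine ⟨fun h v hv => by simpa [quad, bil] using h.2 hv,
    fun h => ⟨?_, fun v hv => by simpa [quad, bil] using h v hv⟩⟩
  rw [Matrix.IsHermitian, Matrix.conjTranspose_eq_transpose_of_trivial]
  exact A.isSymm

theorem continuous_quad (v : Fin d → ℝ) : Continuous fun A : SymMat d => A.quad v := by
  have h := (continuous_mat (d := d)).matrix_mulVec (continuous_const (y := v))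
  exact continuous_const.dotProduct h

instance : OrderClosedTopology (SymMat d) where
  isClosed_le' := by
    simp only [le_def, ofPred_forall]
    exact isClosed_iInter fun v => isClosed_le ((continuous_quad v).comp continuous_fst)
      ((continuous_quad v).comp continuous_snd)

/-- The identity matrix. -/
def one (d : ℕ) : SymMat d := mk 1 Matrix.isSymm_one

@[simp]
theorem one_quad (v : Fin d → ℝ) : (one d).quad v = v ⬝ᵥ v := by
  simp [one, quad, bil]

theorem one_nonneg : 0 ≤ one d := nonneg_iff.2 fun v => by
  simpa using dotProduct_star_self_nonneg v

/-! ### Comparison of the Hilbert-Schmidt norm with the Loewner order. -/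

theorem norm_sq_eq (A : SymMat d) : ‖A‖ ^ 2 = ∑ i, ∑ j, A.mat i j ^ 2 := by
  rw [← real_inner_self_eq_norm_sq, inner_eq]
  simp only [Matrix.trace, Matrix.diag_apply, Matrix.mul_apply, Matrix.transpose_apply]
  rw [Finset.sum_comm]
  exact Finset.sum_congr rfl fun i _ => Finset.sum_congr rfl fun j _ => by ring

theorem abs_entry_le_norm (A : SymMat d) (i j : Fin d) : |A.mat i j| ≤ ‖A‖ := by
  refine abs_le_of_sq_le_sq ?_ (norm_nonneg _)
  rw [norm_sq_eq]
  refine (Finset.single_le_sum (f := fun j => A.mat i j ^ 2) (fun j _ => sq_nonneg _)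
    (Finset.mem_univ j)).trans ?_
  exact Finset.single_le_sum (f := fun i => ∑ j, A.mat i j ^ 2)
    (fun i _ => Finset.sum_nonneg fun j _ => sq_nonneg _) (Finset.mem_univ i)

theorem norm_le_of_entry_le {A : SymMat d} {t : ℝ} (ht : 0 ≤ t) (h : ∀ i j, |A.mat i j| ≤ t) :
    ‖A‖ ≤ d * t := by
  refine le_of_sq_le_sq ?_ (by positivity)
  rw [norm_sq_eq]
  calc ∑ i, ∑ j, A.mat i j ^ 2 ≤ ∑ _i : Fin d, ∑ _j : Fin d, t ^ 2 :=
        Finset.sum_le_sum fun i _ => Finset.sum_le_sum fun j _ => sq_le_sq'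
          (abs_le.1 (h i j)).1 (abs_le.1 (h i j)).2
    _ = (d * t) ^ 2 := by simp; ring

/-- Cauchy-Schwarz on each row: the operator norm is at most the Hilbert-Schmidt norm. -/
theorem dotProduct_self_mulVec_le (P : Matrix (Fin d) (Fin d) ℝ) (v : Fin d → ℝ) :
    P.mulVec v ⬝ᵥ P.mulVec v ≤ (P.transpose * P).trace * (v ⬝ᵥ v) := by
  have h : (P.transpose * P).trace = ∑ i, ∑ j, P i j ^ 2 := by
    simp only [Matrix.trace, Matrix.diag_apply, Matrix.mul_apply, Matrix.transpose_apply]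
    rw [Finset.sum_comm]
    exact Finset.sum_congr rfl fun i _ => Finset.sum_congr rfl fun j _ => by ring
  rw [h, Finset.sum_mul]
  refine Finset.sum_le_sum fun i _ => ?_
  have := Finset.sum_mul_sq_le_sq_mul_sq Finset.univ (P i) v
  simp only [Matrix.mulVec, dotProduct, ← sq]
  exact this

theorem abs_quad_le (A : SymMat d) (v : Fin d → ℝ) : |A.quad v| ≤ ‖A‖ * (v ⬝ᵥ v) := by
  have h0 : 0 ≤ v ⬝ᵥ v := by simpa using dotProduct_star_self_nonneg v
  refine abs_le_of_sq_le_sq ?_ (by positivity)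
  have h1 : (A.quad v) ^ 2 ≤ (v ⬝ᵥ v) * (A.mat.mulVec v ⬝ᵥ A.mat.mulVec v) := by
    have := Finset.sum_mul_sq_le_sq_mul_sq Finset.univ v (A.mat.mulVec v)
    simpa only [quad, bil, dotProduct, ← sq] using this
  have h2 := dotProduct_self_mulVec_le A.mat v
  have h3 : (A.mat.transpose * A.mat).trace = ‖A‖ ^ 2 := by
    rw [← real_inner_self_eq_norm_sq, inner_eq]
  rw [h3] at h2
  calc (A.quad v) ^ 2 ≤ (v ⬝ᵥ v) * (‖A‖ ^ 2 * (v ⬝ᵥ v)) :=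
        h1.trans (mul_le_mul_of_nonneg_left h2 h0)
    _ = (‖A‖ * (v ⬝ᵥ v)) ^ 2 := by ring

theorem le_norm_smul_one (A : SymMat d) : A ≤ ‖A‖ • one d := fun v => by
  simpa using (le_abs_self _).trans (A.abs_quad_le v)

theorem neg_norm_smul_one_le (A : SymMat d) : -(‖A‖ • one d) ≤ A := fun v => by
  simpa using neg_le.1 ((neg_le_abs _).trans (A.abs_quad_le v))

open scoped MatrixOrder Matrix.Norms.L2Operator in
theorem exists_eq_transpose_mul_self {A : SymMat d} (hA : 0 ≤ A) :
    ∃ B : Matrix (Fin d) (Fin d) ℝ, A.mat = B.transpose * B := by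
  obtain ⟨B, hB⟩ := CStarAlgebra.nonneg_iff_eq_star_mul_self.1 (posSemidef_iff.2 hA).nonneg
  exact ⟨B, by simpa [Matrix.star_eq_conjTranspose] using hB⟩

theorem quad_eq_sum {A : SymMat d} {B : Matrix (Fin d) (Fin d) ℝ} (h : A.mat = B.transpose * B)
    (v : Fin d → ℝ) : A.quad v = ∑ k, (B k ⬝ᵥ v) ^ 2 := by
  rw [quad, bil, h, ← Matrix.mulVec_mulVec, Matrix.dotProduct_mulVec, Matrix.vecMul_transpose]
  simp only [dotProduct, Matrix.mulVec, sq]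

/-- With `B = ᵗC C`, the trace of `A B` is the sum of the values of the form `A` at the rows of `C`.
-/
theorem inner_nonneg_of_nonneg {A B : SymMat d} (hA : 0 ≤ A) (hB : 0 ≤ B) :
    0 ≤ inner ℝ A B := by
  obtain ⟨C, hC⟩ := exists_eq_transpose_mul_self hB
  have hA' : A.mat.transpose = A.mat := A.isSymm
  rw [inner_eq, hC, hA', ← Matrix.mul_assoc, Matrix.trace_mul_comm, ← Matrix.mul_assoc]
  rw [Matrix.trace]
  refine Finset.sum_nonneg fun i _ => ?_
  have := nonneg_iff.1 hA (C i)
  simp only [quad, bil] at this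
  rw [Matrix.diag_apply, Matrix.mul_assoc, Matrix.mul_apply]
  simpa [dotProduct, Matrix.mulVec, Matrix.mul_apply] using this

/-- Pairing `A` with `B - A` gives `‖A‖² ≤ (A, B) ≤ ‖A‖ ‖B‖`. -/
theorem norm_le_norm_of_nonneg {A B : SymMat d} (hA : 0 ≤ A) (h : A ≤ B) : ‖A‖ ≤ ‖B‖ := by
  have h1 : 0 ≤ inner ℝ A (B - A) := inner_nonneg_of_nonneg hA (sub_nonneg.2 h)
  rw [inner_sub_right, real_inner_self_eq_norm_sq] at h1
  have h2 := real_inner_le_norm A B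
  by_contra! hlt
  nlinarith [norm_nonneg A, norm_nonneg B]

/-- Since `0 ≤ A + B ≤ 2B`, monotonicity of the norm bounds `A + B` by `2 ‖B‖`, and removing `B`
costs one more. This 3 is the normality constant of the cone of fields. -/
theorem norm_le_of_neg_le_of_le {A B : SymMat d} (h : -B ≤ A) (h' : A ≤ B) :
    ‖A‖ ≤ 3 * ‖B‖ := by
  have h1 : 0 ≤ A + B := by simpa using add_le_add_left h B
  have h2 : A + B ≤ B + B := add_le_add_left h' B
  have h3 := norm_le_norm_of_nonneg h1 h2
  have h4 := norm_sub_le (A + B) B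
  have h5 := norm_add_le B B
  rw [add_sub_cancel_right] at h4
  linarith

theorem inner_one (A : SymMat d) : inner ℝ (one d) A = A.mat.trace := by
  simp [inner_eq, one]

/-- Pairing `A` with `‖A‖ Id - A ≥ 0` gives `‖A‖² ≤ ‖A‖ tr A`. -/
theorem norm_le_trace {A : SymMat d} (hA : 0 ≤ A) : ‖A‖ ≤ A.mat.trace := by
  have h := inner_nonneg_of_nonneg hA (sub_nonneg.2 A.le_norm_smul_one)
  rw [inner_sub_right, real_inner_self_eq_norm_sq, inner_smul_right, real_inner_comm,
    inner_one] at h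
  rcases (norm_nonneg A).eq_or_lt with h0 | h0
  · rw [← h0, ← inner_one]
    exact inner_nonneg_of_nonneg one_nonneg hA
  · nlinarith

/-- Young's inequality for the form `A`: expand `0 ≤ A(t u - h)` and divide by `t`. -/
theorem quad_add_le {A : SymMat d} (hA : 0 ≤ A) {t : ℝ} (ht : 0 < t) (u h : Fin d → ℝ) :
    A.quad (u + h) ≤ (1 + t) * A.quad u + (1 + 1 / t) * A.quad h := by
  have h1 := nonneg_iff.1 hA (t • u + (-1 : ℝ) • h)
  rw [quad_add, quad_smul, quad_smul, bil_smul_right, bil_comm, bil_smul_right, bil_comm] at h1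
  rw [quad_add]
  have h2 : 2 * A.bil u h ≤ t * A.quad u + 1 / t * A.quad h := by
    have : 2 * A.bil u h = (t * (2 * A.bil u h)) / t := by field_simp
    have h3 : t * A.quad u + 1 / t * A.quad h = (t ^ 2 * A.quad u + A.quad h) / t := by
      field_simp
    rw [this, h3]
    gcongr
    linarith
  linarith

/-- A nondegenerate family of matrices spreads a positive semidefinite form over all directions. -/
theorem sum_quad_ge {n : ℕ} {D : Fin n → Matrix (Fin d) (Fin d) ℝ} {b : ℝ}
    (hD : ∀ v w : Fin d → ℝ, ∃ i,
      b ^ 2 * (v ⬝ᵥ v) * (w ⬝ᵥ w) ≤ (w ⬝ᵥ (D i).mulVec v) ^ 2)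
    {A : SymMat d} (hA : 0 ≤ A) (v : Fin d → ℝ) :
    b ^ 2 * ‖A‖ * (v ⬝ᵥ v) ≤ ∑ i, A.quad ((D i).mulVec v) := by
  obtain ⟨B, hB⟩ := exists_eq_transpose_mul_self hA
  have h0 : 0 ≤ v ⬝ᵥ v := by simpa using dotProduct_star_self_nonneg v
  have htr : A.mat.trace = ∑ k, B k ⬝ᵥ B k := by
    rw [hB, Matrix.trace_mul_comm]
    simp [Matrix.trace, Matrix.mul_apply, dotProduct]
  calc b ^ 2 * ‖A‖ * (v ⬝ᵥ v) ≤ b ^ 2 * A.mat.trace * (v ⬝ᵥ v) := by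
        gcongr
        exact norm_le_trace hA
    _ = ∑ k, b ^ 2 * (v ⬝ᵥ v) * (B k ⬝ᵥ B k) := by
        rw [htr, ← Finset.mul_sum]
        ring
    _ ≤ ∑ k, ∑ i, (B k ⬝ᵥ (D i).mulVec v) ^ 2 := by
        refine Finset.sum_le_sum fun k _ => ?_
        -- The index depends on the row `B k`, which is why the conclusion needs the sum over all
        -- `i`.
        obtain ⟨i, hi⟩ := hD v (B k)
        exact hi.trans (Finset.single_le_sum
          (f := fun i => (B k ⬝ᵥ (D i).mulVec v) ^ 2) (fun i _ => sq_nonneg _)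
          (Finset.mem_univ i))
    _ = ∑ i, A.quad ((D i).mulVec v) := by
        rw [Finset.sum_comm]
        exact Finset.sum_congr rfl fun i _ => (quad_eq_sum hB _).symm

end SymMat

/-! ### Operators contracting a cone -/

/-- A linear operator `L` which maps a closed normal convex cone `K` well inside itself: `L u` is
comparable, in the order of `K` and with constants proportional to `‖u‖`, to a fixed `e ∈ K`. -/
structure ContractsCone {X : Type*} [NormedAddCommGroup X] [NormedSpace ℝ X]
    (K : Set X) (L : Module.End ℝ X) (e : X) (c C N : ℝ) : Prop where
  isClosed : IsClosed K
  add_mem : ∀ {u v}, u ∈ K → v ∈ K → u + v ∈ K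
  smul_mem : ∀ {t : ℝ} {u}, 0 ≤ t → u ∈ K → t • u ∈ K
  normal : ∀ {u v}, u - v ∈ K → u + v ∈ K → ‖v‖ ≤ N * ‖u‖
  continuous : Continuous L
  mem : e ∈ K
  ne_zero : e ≠ 0
  pos : 0 < c
  le : c ≤ C
  lower : ∀ {u}, u ∈ K → L u - (c * ‖u‖) • e ∈ K
  upper : ∀ {u}, u ∈ K → (C * ‖u‖) • e - L u ∈ K

namespace ContractsCone

variable {X : Type*} [NormedAddCommGroup X] [NormedSpace ℝ X] {K : Set X} {L : Module.End ℝ X}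
  {e : X} {c C N : ℝ}

/-- The rate of contraction. -/
def rate (c C : ℝ) : ℝ := 1 - c / (2 * C)

variable (h : ContractsCone K L e c C N)
include h

theorem pos' : 0 < C := h.pos.trans_le h.le

theorem rate_pos : 0 < rate c C := by
  have := h.pos'
  have h2 := h.le
  rw [rate, sub_pos, div_lt_one (by positivity)]
  linarith

theorem rate_lt_one : rate c C < 1 := by
  have := h.pos'
  have h2 := h.pos
  rw [rate]
  linarith [show 0 < c / (2 * C) by positivity]

theorem map_mem {u : X} (hu : u ∈ K) : L u ∈ K := by
  have h1 := h.add_mem (h.lower hu)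
    (h.smul_mem (mul_nonneg h.pos.le (norm_nonneg u)) h.mem)
  rwa [sub_add_cancel] at h1

theorem pow_map_mem {u : X} (hu : u ∈ K) (l : ℕ) : (L ^ l) u ∈ K := by
  induction l with
  | zero => simpa using hu
  | succ l ih =>
    rw [pow_succ', Module.End.mul_apply]
    exact h.map_mem ih

/-- In the order of `K`: `L w ≥ c ‖w‖ e ≥ (c R ‖u‖ / 2) e ≥ (c / (2C)) R L u`, the last step by the
upper bound on `L u`. -/
theorem sub_smul_map_mem {u w : X} {R : ℝ} (hR : 0 ≤ R) (hu : u ∈ K) (hw : w ∈ K)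
    (hle : R * ‖u‖ / 2 ≤ ‖w‖) : L w - (c / (2 * C) * R) • L u ∈ K := by
  have hC := h.pos'
  have hc := h.pos
  have h1 := h.lower hw
  have h2 := h.smul_mem (t := c / (2 * C) * R) (by positivity) (h.upper hu)
  have h3 := h.smul_mem (t := c * ‖w‖ - c / (2 * C) * R * (C * ‖u‖)) (by
    have : c / (2 * C) * R * (C * ‖u‖) = c * (R * ‖u‖ / 2) := by field_simp
    rw [this, ← mul_sub]
    exact mul_nonneg hc.le (sub_nonneg.2 hle)) h.mem
  have h4 := h.add_mem (h.add_mem h1 h2) h3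
  convert h4 using 1
  module

/-- As `(M - m) u = (v - m u) + (M u - v)`, one summand has norm at least `(M - m) ‖u‖ / 2`. The
endpoint attached to it moves inwards by `c / (2C) (M - m)`; the other one stays. -/
theorem exists_step {u v : X} {m M : ℝ} (hmM : m ≤ M) (hu : u ∈ K) (hm : v - m • u ∈ K)
    (hM : M • u - v ∈ K) : ∃ m' M' : ℝ, m ≤ m' ∧ M' ≤ M ∧ M' - m' = rate c C * (M - m) ∧
      L v - m' • L u ∈ K ∧ M' • L u - L v ∈ K := by
  have hC := h.pos'
  have hc := h.pos
  have hε : 0 ≤ c / (2 * C) * (M - m) := mul_nonneg (by positivity) (sub_nonneg.2 hmM)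
  have hsum : (M - m) * ‖u‖ ≤ ‖v - m • u‖ + ‖M • u - v‖ := by
    have h1 : (M - m) • u = (v - m • u) + (M • u - v) := by module
    have h2 := norm_add_le (v - m • u) (M • u - v)
    rwa [← h1, norm_smul, Real.norm_of_nonneg (sub_nonneg.2 hmM)] at h2
  have hm' := h.map_mem hm
  have hM' := h.map_mem hM
  simp only [map_sub, map_smul] at hm' hM'
  rcases le_total ((M - m) * ‖u‖ / 2) ‖v - m • u‖ with hA | hA
  · refine ⟨m + c / (2 * C) * (M - m), M, by linarith, le_rfl, by rw [rate]; ring, ?_, hM'⟩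
    have h1 := h.sub_smul_map_mem (sub_nonneg.2 hmM) hu hm hA
    rw [map_sub, map_smul] at h1
    convert h1 using 1
    module
  · refine ⟨m, M - c / (2 * C) * (M - m), le_rfl, by linarith, by rw [rate]; ring, hm', ?_⟩
    have h1 := h.sub_smul_map_mem (sub_nonneg.2 hmM) hu hM (by linarith)
    rw [map_sub, map_smul] at h1
    convert h1 using 1
    module

/-- Iterating the step gives nested intervals of length `rate c C ^ l * (M - m)`, and `t` is a point
common to all of them. Since `t` and the true ratio lie in the same interval, its length controls
`L^l v - t L^l u` on both sides. -/
theorem exists_ratio {u v : X} {m M : ℝ} (hmM : m ≤ M) (hu : u ∈ K) (hm : v - m • u ∈ K)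
    (hM : M • u - v ∈ K) : ∃ t, m ≤ t ∧ t ≤ M ∧ ∀ l : ℕ,
      (rate c C ^ l * (M - m)) • (L ^ l) u - ((L ^ l) v - t • (L ^ l) u) ∈ K ∧
      (rate c C ^ l * (M - m)) • (L ^ l) u + ((L ^ l) v - t • (L ^ l) u) ∈ K := by
  let Good : ℕ → ℝ × ℝ → Prop := fun l p => p.1 ≤ p.2 ∧ p.2 - p.1 = rate c C ^ l * (M - m) ∧
    (L ^ l) v - p.1 • (L ^ l) u ∈ K ∧ p.2 • (L ^ l) u - (L ^ l) v ∈ K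
  have step : ∀ (l : ℕ) (p : {p // Good l p}),
      ∃ p' : {p // Good (l + 1) p}, p.1.1 ≤ p'.1.1 ∧ p'.1.2 ≤ p.1.2 := by
    rintro l ⟨p, h1, h2, h3, h4⟩
    obtain ⟨m', M', h5, h6, h7, h8, h9⟩ := h.exists_step h1 (h.pow_map_mem hu l) h3 h4
    refine ⟨⟨(m', M'), ?_, ?_, ?_, ?_⟩, h5, h6⟩
    · have := mul_nonneg h.rate_pos.le (sub_nonneg.2 h1)
      simp only
      linarith
    · simp only [h7, h2]
      ring
    · simpa only [pow_succ', Module.End.mul_apply] using h8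
    · simpa only [pow_succ', Module.End.mul_apply] using h9
  choose next hnext using step
  let f : (l : ℕ) → {p // Good l p} := fun l =>
    Nat.rec ⟨(m, M), hmM, by simp, by simpa using hm, by simpa using hM⟩ (fun l p => next l p) l
  have hf : ∀ l, (f l).1.1 ≤ (f (l + 1)).1.1 ∧ (f (l + 1)).1.2 ≤ (f l).1.2 :=
    fun l => hnext l (f l)
  have mono : Monotone fun l => (f l).1.1 := monotone_nat_of_le_succ fun l => (hf l).1
  have anti : Antitone fun l => (f l).1.2 := antitone_nat_of_succ_le fun l => (hf l).2
  have hmem := mono.ciSup_mem_iInter_Icc_of_antitone anti fun l => (f l).2.1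
  set t := ⨆ l, (f l).1.1
  have ht : ∀ l, (f l).1.1 ≤ t ∧ t ≤ (f l).1.2 := fun l => mem_iInter.1 hmem l
  refine ⟨t, (ht 0).1, (ht 0).2, fun l => ?_⟩
  obtain ⟨h1, h2, h3, h4⟩ := (f l).2
  have h5 := ht l
  have hul := h.pow_map_mem hu l
  constructor
  · have h6 := h.add_mem h4 (h.smul_mem (t := t - (f l).1.1) (by linarith) hul)
    convert h6 using 1
    rw [← h2]
    module
  · have h6 := h.add_mem h3 (h.smul_mem (t := (f l).1.2 - t) (by linarith) hul)
    convert h6 using 1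
    rw [← h2]
    module

/-- If `L^{l+1} e = 0`, the lower bound puts a negative multiple of `e` in `K`, which normality
forbids. -/
theorem pow_map_ne_zero (l : ℕ) : (L ^ l) e ≠ 0 := by
  induction l with
  | zero => simpa using h.ne_zero
  | succ l ih =>
    intro h0
    rw [pow_succ', Module.End.mul_apply] at h0
    have hpos : 0 < c * ‖(L ^ l) e‖ := mul_pos h.pos (norm_pos_iff.2 ih)
    have h1 := h.lower (h.pow_map_mem h.mem l)
    rw [h0] at h1
    have h2 := h.normal h1 (by simpa using h.smul_mem hpos.le h.mem)
    rw [norm_zero, mul_zero, norm_smul, Real.norm_of_nonneg hpos.le] at h2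
    exact (mul_pos hpos (norm_pos_iff.2 h.ne_zero)).not_ge h2

/-- Existence of a positive eigenvector. -/
theorem exists_eigenvector [CompleteSpace X] :
    ∃ β : ℝ, 0 < β ∧ ∃ Q ∈ K, ‖Q‖ = 1 ∧ L Q = β • Q := by
  have he : 0 < ‖e‖ := norm_pos_iff.2 h.ne_zero
  -- The eigenvalue is the limiting ratio of `L^{l+1} e` to `L^l e`; it is positive because it is at
  -- least `c ‖e‖`.
  obtain ⟨β, hβ, -, hl⟩ := h.exists_ratio (u := e) (v := L e) (m := c * ‖e‖) (M := C * ‖e‖)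
    (mul_le_mul_of_nonneg_right h.le he.le) h.mem (h.lower h.mem) (h.upper h.mem)
  have hβ0 : 0 < β := (mul_pos h.pos he).trans_le hβ
  set q := rate c C
  set R := C * ‖e‖ - c * ‖e‖
  have hR : 0 ≤ R := sub_nonneg.2 (mul_le_mul_of_nonneg_right h.le he.le)
  have hq : 0 < q := h.rate_pos
  set u : ℕ → X := fun l => (L ^ l) e with hu
  have hu0 : ∀ l, 0 < ‖u l‖ := fun l => norm_pos_iff.2 (h.pow_map_ne_zero l)
  have hus : ∀ l, u (l + 1) = L (u l) := fun l => by
    simp only [hu, pow_succ', Module.End.mul_apply]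
  have hdiff : ∀ l, ‖L (u l) - β • u l‖ ≤ N * (q ^ l * R) * ‖u l‖ := fun l => by
    have h1 := h.normal (hl l).1 (hl l).2
    rw [norm_smul, Real.norm_of_nonneg (by positivity), ← mul_assoc] at h1
    have h2 : (L ^ l) (L e) = L (u l) := by
      rw [← hus, hu]
      simp only [pow_succ, Module.End.mul_apply]
    rwa [h2] at h1
  set w : ℕ → X := fun l => ‖u l‖⁻¹ • u l with hw
  have hw1 : ∀ l, ‖w l‖ = 1 := fun l => by
    rw [hw]
    simp only [norm_smul, norm_inv, norm_norm]
    exact inv_mul_cancel₀ (hu0 l).ne'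
  have hLw : ∀ l, ‖L (w l) - β • w l‖ ≤ N * R * q ^ l := fun l => by
    have h1 : L (w l) - β • w l = ‖u l‖⁻¹ • (L (u l) - β • u l) := by
      simp only [hw, map_smul]
      module
    rw [h1, norm_smul, norm_inv, norm_norm, inv_mul_le_iff₀ (hu0 l)]
    refine (hdiff l).trans (le_of_eq (by ring))
  -- Here `L (w l) = ‖L (w l)‖ • w (l + 1)`, and `‖L (w l)‖` differs from `β` by at most `‖L (w l) -
  -- β • w l‖`; this error therefore enters twice.
  have hstep : ∀ l, dist (w l) (w (l + 1)) ≤ 2 * (N * R) / β * q ^ l := fun l => by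
    have h1 : β • (w (l + 1) - w l) =
        (L (w l) - β • w l) - (‖L (w l)‖ - ‖β • w l‖) • w (l + 1) := by
      have h2 : L (w l) = ‖L (w l)‖ • w (l + 1) := by
        simp only [hw, hus, map_smul, norm_smul, norm_inv, norm_norm, smul_smul]
        rw [mul_assoc, mul_inv_cancel₀ (by rw [← hus]; exact (hu0 _).ne'), mul_one]
      rw [norm_smul, hw1, Real.norm_of_nonneg hβ0.le]
      nth_rw 1 [h2]
      module
    have h3 : β * ‖w (l + 1) - w l‖ ≤ 2 * (N * R * q ^ l) := by
      calc β * ‖w (l + 1) - w l‖ = ‖β • (w (l + 1) - w l)‖ := by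
            rw [norm_smul, Real.norm_of_nonneg hβ0.le]
        _ ≤ ‖L (w l) - β • w l‖ + |‖L (w l)‖ - ‖β • w l‖| * ‖w (l + 1)‖ := by
            rw [h1]
            refine (norm_sub_le _ _).trans (le_of_eq ?_)
            rw [norm_smul, Real.norm_eq_abs]
        _ ≤ 2 * (N * R * q ^ l) := by
            rw [hw1, mul_one]
            have := abs_norm_sub_norm_le (L (w l)) (β • w l)
            linarith [hLw l]
    rw [dist_comm, dist_eq_norm, div_mul_eq_mul_div, le_div_iff₀ hβ0]
    linarith
  obtain ⟨Q, hQ⟩ := cauchySeq_tendsto_of_complete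
    (cauchySeq_of_le_geometric q _ h.rate_lt_one hstep)
  refine ⟨β, hβ0, Q, ?_, ?_, ?_⟩
  · exact h.isClosed.mem_of_tendsto hQ (Eventually.of_forall fun l =>
      h.smul_mem (by positivity) (h.pow_map_mem h.mem l))
  · have h1 := hQ.norm
    simp only [hw1] at h1
    exact tendsto_nhds_unique h1 tendsto_const_nhds |>.symm ▸ rfl
  · have h1 : Tendsto (fun l => L (w l) - β • w l) atTop (𝓝 (L Q - β • Q)) :=
      ((h.continuous.tendsto Q).comp hQ).sub (hQ.const_smul β)
    have h2 : Tendsto (fun l => L (w l) - β • w l) atTop (𝓝 0) := by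
      refine squeeze_zero_norm hLw ?_
      simpa using (tendsto_pow_atTop_nhds_zero_of_lt_one hq.le h.rate_lt_one).const_mul (N * R)
    exact sub_eq_zero.1 (tendsto_nhds_unique h1 h2)

omit h in
theorem pow_map_eigenvector {β : ℝ} {Q : X} (hQ : L Q = β • Q) (l : ℕ) :
    (L ^ l) Q = β ^ l • Q := by
  induction l with
  | zero => simp
  | succ l ih => rw [pow_succ', Module.End.mul_apply, ih, map_smul, hQ, smul_smul, pow_succ]

/-- Exponential convergence to the positive eigenvector. -/
theorem exists_norm_sub_le {β : ℝ} (hβ : 0 < β) {Q : X} (hQK : Q ∈ K) (hQ : L Q = β • Q)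
    {v : X} {m M : ℝ} (hmM : m ≤ M) (hm : v - m • Q ∈ K) (hM : M • Q - v ∈ K) :
    ∃ t : ℝ, ∀ l : ℕ,
      ‖(β ^ l)⁻¹ • (L ^ l) v - t • Q‖ ≤ N * (M - m) * ‖Q‖ * rate c C ^ l := by
  obtain ⟨t, -, -, ht⟩ := h.exists_ratio hmM hQK hm hM
  refine ⟨t, fun l => ?_⟩
  have hβl : 0 < β ^ l := pow_pos hβ l
  have hq := h.rate_pos
  have hR := sub_nonneg.2 hmM
  have h1 := h.normal (ht l).1 (ht l).2
  rw [pow_map_eigenvector hQ, norm_smul, norm_smul, Real.norm_of_nonneg (by positivity),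
    Real.norm_of_nonneg hβl.le] at h1
  have h2 : (β ^ l)⁻¹ • (L ^ l) v - t • Q = (β ^ l)⁻¹ • ((L ^ l) v - t • β ^ l • Q) := by
    rw [smul_sub, smul_comm t, smul_smul (β ^ l)⁻¹, inv_mul_cancel₀ hβl.ne', one_smul]
  rw [h2, norm_smul, norm_inv, Real.norm_of_nonneg hβl.le, inv_mul_le_iff₀ hβl]
  exact h1.trans (le_of_eq (by ring))

end ContractsCone

/-! ### The transfer operator on the cone of Hölder fields of matrices -/

section Transfer

variable {d n : ℕ} {E : Type} [MetricSpace E]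

/-- The closed cone of the continuous fields `A` of positive semidefinite matrices with
`e^{-a dist(x,y)^ν} A_x ≤ A_y` for all `x, y`. -/
def semiCone (E : Type) [MetricSpace E] (d : ℕ) (a ν : ℝ) : Set C(E, SymMat d) :=
  {A | (∀ x, 0 ≤ A x) ∧ ∀ x y, Real.exp (-(a * dist x y ^ ν)) • A x ≤ A y}

/-- The constant field of identity matrices. -/
def oneField (E : Type) [MetricSpace E] (d : ℕ) : C(E, SymMat d) :=
  ContinuousMap.const E (SymMat.one d)

@[simp]
theorem oneField_apply (x : E) : oneField E d x = SymMat.one d := rfl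

/-- The upper inequality at `(x, y)` is the lower one at `(y, x)`, so one of the two suffices. -/
theorem mem_holderCone_iff {a ν : ℝ} {A : C(E, SymMat d)} :
    A ∈ holderCone dist a ν ↔ (∀ x, (A x).mat.PosDef) ∧ A ∈ semiCone E d a ν := by
  refine and_congr_right fun hpos => ⟨fun h => ⟨fun x => ?_, fun x y => ?_⟩, fun h x y => ?_⟩
  · exact SymMat.posSemidef_iff.1 (hpos x).posSemidef
  · exact SymMat.sub_posSemidef_iff.1 (h x y).1
  · refine ⟨SymMat.sub_posSemidef_iff (A := Real.exp _ • A x).2 (h.2 x y),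
      SymMat.sub_posSemidef_iff (B := Real.exp _ • A x).2 ?_⟩
    have h1 := smul_le_smul_of_nonneg_left (h.2 y x) (Real.exp_pos (a * dist x y ^ ν)).le
    rwa [dist_comm y x, smul_smul, ← Real.exp_add, add_neg_cancel, Real.exp_zero, one_smul] at h1

theorem isClosed_semiCone (a ν : ℝ) : IsClosed (semiCone E d a ν) := by
  have h : ∀ x : E, Continuous fun A : C(E, SymMat d) => A x :=
    fun x => continuous_eval_const x
  simp only [semiCone, ofPred_and, ofPred_forall]
  refine (isClosed_iInter fun x => isClosed_le continuous_const (h x)).inter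
    (isClosed_iInter fun x => isClosed_iInter fun y => isClosed_le ((h x).fun_const_smul _) (h y))

theorem transferOp_quad (s : Fin n → C(E, E)) (D : Fin n → C(E, Matrix (Fin d) (Fin d) ℝ))
    (A : C(E, SymMat d)) (x : E) (v : Fin d → ℝ) :
    (transferOp s D A x).quad v = ∑ i, (A (s i x)).quad ((D i x).mulVec v) := by
  change (∑ i, SymMat.congr (D i x) (A (s i x))).quad v = _
  rw [SymMat.sum_quad]
  exact Finset.sum_congr rfl fun i _ => SymMat.congr_quad _ _ _

theorem transferOp_nonneg {s : Fin n → C(E, E)} {D : Fin n → C(E, Matrix (Fin d) (Fin d) ℝ)}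
    {A : C(E, SymMat d)} (hA : ∀ x, 0 ≤ A x) (x : E) : 0 ≤ transferOp s D A x :=
  SymMat.nonneg_iff.2 fun v => by
    rw [transferOp_quad]
    exact Finset.sum_nonneg fun i _ => SymMat.nonneg_iff.1 (hA _) _

theorem transferOp_mono {s : Fin n → C(E, E)} {D : Fin n → C(E, Matrix (Fin d) (Fin d) ℝ)}
    {A B : C(E, SymMat d)} (h : ∀ x, A x ≤ B x) (x : E) :
    transferOp s D A x ≤ transferOp s D B x := by
  have h1 := transferOp_nonneg (s := s) (D := D) (A := B - A) (fun x => sub_nonneg.2 (h x)) x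
  rw [map_sub] at h1
  exact sub_nonneg.1 h1

/-- Hypotheses on the maps `s_i` and the matrix fields `D_i` under which the transfer operator
contracts the cone `semiCone E d a ν`. -/
structure TransferData (s : Fin n → C(E, E)) (D : Fin n → C(E, Matrix (Fin d) (Fin d) ℝ))
    (r ν a b ω : ℝ) : Prop where
  r_nonneg : 0 ≤ r
  ν_pos : 0 < ν
  ν_le_one : ν ≤ 1
  a_pos : 0 < a
  b_pos : 0 < b
  ω_pos : 0 < ω
  dist_le_one : ∀ x y : E, dist x y ≤ 1
  contracting : ∀ i x y, dist (s i x) (s i y) ≤ r * dist x y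
  holder : ∀ i x y, hsNorm (D i x - D i y) ≤ ω * dist x y ^ ν
  nondegenerate : ∀ x, ∀ v w : Fin d → ℝ, ∃ i,
    b ^ 2 * (v ⬝ᵥ v) * (w ⬝ᵥ w) ≤ (w ⬝ᵥ (D i x).mulVec v) ^ 2
  gap : a * r ^ ν + (ω + (ω + ω ^ 2) * (n * Real.exp a / b ^ 2)) < a

/-- The Hölder constant of the image of the cone. -/
def imageConst (n : ℕ) (r ν a b ω : ℝ) : ℝ :=
  a * r ^ ν + (ω + (ω + ω ^ 2) * (n * Real.exp a / b ^ 2))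

variable [CompactSpace E]

theorem field_le_norm (A : C(E, SymMat d)) (x : E) : A x ≤ ‖A‖ • SymMat.one d :=
  (A x).le_norm_smul_one.trans
    (SymMat.smul_le_smul_of_le SymMat.one_nonneg (A.norm_coe_le_norm x))

theorem neg_norm_le_field (A : C(E, SymMat d)) (x : E) : -(‖A‖ • SymMat.one d) ≤ A x := by
  refine le_trans (neg_le_neg ?_) (A x).neg_norm_smul_one_le
  exact SymMat.smul_le_smul_of_le SymMat.one_nonneg (A.norm_coe_le_norm x)

theorem norm_le_of_abs_le {A B : C(E, SymMat d)} (h : ∀ x, -B x ≤ A x) (h' : ∀ x, A x ≤ B x) :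
    ‖A‖ ≤ 3 * ‖B‖ := by
  refine (ContinuousMap.norm_le _ (by positivity)).2 fun x => ?_
  refine (SymMat.norm_le_of_neg_le_of_le (h x) (h' x)).trans ?_
  gcongr
  exact B.norm_coe_le_norm x

/-- By positivity, `L A` lies between `±‖A‖ L(Id)`. -/
theorem norm_transferOp_le (s : Fin n → C(E, E)) (D : Fin n → C(E, Matrix (Fin d) (Fin d) ℝ))
    (A : C(E, SymMat d)) :
    ‖transferOp s D A‖ ≤ 3 * ‖transferOp s D (oneField E d)‖ * ‖A‖ := by
  have h1 : ∀ x, transferOp s D A x ≤ transferOp s D (‖A‖ • oneField E d) x :=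
    transferOp_mono (field_le_norm A)
  have h2 : ∀ x, transferOp s D (-(‖A‖ • oneField E d)) x ≤ transferOp s D A x :=
    transferOp_mono (neg_norm_le_field A)
  rw [map_neg] at h2
  refine (norm_le_of_abs_le h2 h1).trans (le_of_eq ?_)
  rw [map_smul, norm_smul, norm_norm]
  ring

theorem continuous_transferOp (s : Fin n → C(E, E))
    (D : Fin n → C(E, Matrix (Fin d) (Fin d) ℝ)) : Continuous (transferOp s D) :=
  ((transferOp s D).mkContinuous _ (norm_transferOp_le s D)).continuous

theorem exists_norm_apply_eq [Nonempty E] (A : C(E, SymMat d)) : ∃ x, ‖A x‖ = ‖A‖ := by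
  obtain ⟨x, hx⟩ := A.continuous.norm.exists_forall_ge' (x₀ := Classical.arbitrary E) (by simp)
  exact ⟨x, (A.norm_coe_le_norm x).antisymm ((ContinuousMap.norm_le _ (norm_nonneg _)).2 hx)⟩

/-- In the matrix order `A_x - A_y ≤ (1 - e^{-aσ}) A_x ≤ aσ ‖A‖ Id`; exchanging `x` and `y` gives
the other side. -/
theorem norm_sub_le_of_mem_semiCone {a ν : ℝ} (ha : 0 ≤ a) {A : C(E, SymMat d)}
    (hA : A ∈ semiCone E d a ν) (x y : E) :
    ‖A x - A y‖ ≤ 3 * ‖SymMat.one d‖ * a * ‖A‖ * dist x y ^ ν := by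
  have key : ∀ x y, A x - A y ≤ (a * dist x y ^ ν * ‖A‖) • SymMat.one d := fun x y v => by
    have h1 := hA.2 x y v
    have h2 := Real.add_one_le_exp (-(a * dist x y ^ ν))
    have h3 : 0 ≤ a * dist x y ^ ν := by positivity
    have h4 := field_le_norm A x v
    have h5 := SymMat.nonneg_iff.1 (hA.1 x) v
    rw [SymMat.smul_quad] at h1 h4
    rw [SymMat.sub_quad, SymMat.smul_quad]
    have h6 : (1 - Real.exp (-(a * dist x y ^ ν))) * (A x).quad v ≤
        a * dist x y ^ ν * (A x).quad v := mul_le_mul_of_nonneg_right (by linarith) h5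
    have h7 := mul_le_mul_of_nonneg_left h4 h3
    linarith
  have h1 := key x y
  have h2 := key y x
  rw [← neg_sub, dist_comm y x, neg_le] at h2
  refine (SymMat.norm_le_of_neg_le_of_le h2 h1).trans (le_of_eq ?_)
  rw [norm_smul, Real.norm_of_nonneg (by positivity)]
  ring

/-- A Hölder field becomes an element of the cone after adding a large multiple of the identity. -/
theorem smul_oneField_sub_mem {a ν : ℝ} (ha : 0 < a) (hdist : ∀ x y : E, dist x y ≤ 1)
    (hν : 0 < ν) {B : C(E, SymMat d)} {H : ℝ} (hH : 0 ≤ H)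
    (hB : ∀ x y, ‖B x - B y‖ ≤ H * dist x y ^ ν) {T : ℝ} (hT : ‖B‖ + H * Real.exp a / a ≤ T) :
    T • oneField E d - B ∈ semiCone E d a ν := by
  have hT0 : ‖B‖ ≤ T := le_trans (by linarith [show 0 ≤ H * Real.exp a / a by positivity]) hT
  refine ⟨fun x => sub_nonneg.2 ((field_le_norm B x).trans
    (SymMat.smul_le_smul_of_le SymMat.one_nonneg hT0)), fun x y v => ?_⟩
  have hs0 : 0 ≤ dist x y ^ ν := by positivity
  have hs1 : dist x y ^ ν ≤ 1 := Real.rpow_le_one dist_nonneg (hdist x y) hν.le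
  set s := dist x y ^ ν with hs
  have hv : 0 ≤ v ⬝ᵥ v := by simpa using dotProduct_star_self_nonneg v
  have h1 : (B y).quad v - (B x).quad v ≤ H * s * (v ⬝ᵥ v) := by
    have h2 := (le_abs_self _).trans ((B y - B x).abs_quad_le v)
    rw [SymMat.sub_quad] at h2
    refine h2.trans (mul_le_mul_of_nonneg_right ?_ hv)
    rw [norm_sub_rev]
    exact hB x y
  have h3 : (B x).quad v ≤ ‖B‖ * (v ⬝ᵥ v) := by simpa using field_le_norm B x v
  -- The slack produced by `T Id` is `(T - ‖B‖) (1 - e^{-as})`. This linear lower bound, valid for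
  -- `s ≤ 1`, makes it beat `H s` and explains the term `H e^a / a` in the condition on `T`.
  have h4 : a * s * Real.exp (-a) ≤ 1 - Real.exp (-(a * s)) := by
    have h5 := Real.add_one_le_exp (a * s)
    have h6 : Real.exp (-(a * s)) * Real.exp (a * s) = 1 := by
      rw [← Real.exp_add, neg_add_cancel, Real.exp_zero]
    have h7 : Real.exp (-a) ≤ Real.exp (-(a * s)) := Real.exp_le_exp.2 (by nlinarith)
    have h8 : a * s * Real.exp (-(a * s)) ≤ 1 - Real.exp (-(a * s)) := by
      nlinarith [Real.exp_pos (-(a * s))]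
    exact (mul_le_mul_of_nonneg_left h7 (by positivity)).trans h8
  have h9 : H * s ≤ (T - ‖B‖) * (1 - Real.exp (-(a * s))) := by
    have h10 : H * s = H * Real.exp a / a * (a * s * Real.exp (-a)) := by
      rw [Real.exp_neg]
      field_simp
    rw [h10]
    have : 0 ≤ a * s * Real.exp (-a) := by positivity
    exact mul_le_mul (by linarith) h4 this (by linarith)
  have h11 : 0 ≤ 1 - Real.exp (-(a * s)) := le_trans (by positivity) h4
  simp only [ContinuousMap.sub_apply, ContinuousMap.smul_apply, oneField_apply, SymMat.smul_quad,
    SymMat.sub_quad, SymMat.one_quad]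
  nlinarith [mul_le_mul_of_nonneg_right h9 hv, mul_le_mul_of_nonneg_left h3 h11]

/-! ### Strong positivity and contraction of the Hölder cone. -/

namespace TransferData

variable {s : Fin n → C(E, E)} {D : Fin n → C(E, Matrix (Fin d) (Fin d) ℝ)} {r ν a b ω : ℝ}
  (h : TransferData s D r ν a b ω)
include h

omit [CompactSpace E] in
theorem rpow_dist_le_one (x y : E) : dist x y ^ ν ≤ 1 :=
  Real.rpow_le_one dist_nonneg (h.dist_le_one x y) h.ν_pos.le

omit [CompactSpace E] in
theorem exp_neg_smul_le {A : C(E, SymMat d)} (hA : A ∈ semiCone E d a ν) (x y : E) :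
    Real.exp (-a) • A x ≤ A y := by
  refine le_trans (SymMat.smul_le_smul_of_le (hA.1 x) (Real.exp_le_exp.2 ?_)) (hA.2 x y)
  have := h.rpow_dist_le_one x y
  have := h.a_pos
  nlinarith

/-- Let `z` be a point where the norm of `A` is attained. All the values `A (s i x)` dominate
`e^{-a} A z`, and nondegeneracy spreads `A z` over every direction. -/
theorem smul_one_le_transferOp [Nonempty E] {A : C(E, SymMat d)} (hA : A ∈ semiCone E d a ν)
    (x : E) : (Real.exp (-a) * b ^ 2 * ‖A‖) • SymMat.one d ≤ transferOp s D A x := by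
  obtain ⟨z, hz⟩ := exists_norm_apply_eq A
  intro v
  rw [transferOp_quad, SymMat.smul_quad, SymMat.one_quad]
  calc Real.exp (-a) * b ^ 2 * ‖A‖ * (v ⬝ᵥ v)
      = Real.exp (-a) * (b ^ 2 * ‖A z‖ * (v ⬝ᵥ v)) := by rw [hz]; ring
    _ ≤ Real.exp (-a) * ∑ i, (A z).quad ((D i x).mulVec v) := by
        gcongr
        exact SymMat.sum_quad_ge (h.nondegenerate x) (hA.1 z) v
    _ ≤ ∑ i, (A (s i x)).quad ((D i x).mulVec v) := by
        rw [Finset.mul_sum]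
        refine Finset.sum_le_sum fun i _ => ?_
        simpa using h.exp_neg_smul_le hA z (s i x) ((D i x).mulVec v)

/-- The cost of replacing `D i y` by `D i x`. Young's inequality leaves an additive error of order
`‖A‖ |v|² σ`, turned into a multiplicative one by the lower bound on `L A`. -/
theorem sum_quad_le [Nonempty E] {A : C(E, SymMat d)} (hA : A ∈ semiCone E d a ν) {x y : E}
    (v : Fin d → ℝ) : ∑ i, (A (s i y)).quad ((D i x).mulVec v) ≤
      (1 + (ω + (ω + ω ^ 2) * (n * Real.exp a / b ^ 2)) * dist x y ^ ν) *
        (transferOp s D A y).quad v := by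
  -- Young's inequality is used with parameter `ω σ`, which must be positive.
  rcases eq_or_ne x y with rfl | hxy
  · rw [transferOp_quad, dist_self, Real.zero_rpow h.ν_pos.ne', mul_zero, add_zero, one_mul]
  have hω := h.ω_pos
  have hb := h.b_pos
  have hσ0 : 0 < dist x y ^ ν := Real.rpow_pos_of_pos (dist_pos.2 hxy) _
  have hσ1 := h.rpow_dist_le_one x y
  set σ := dist x y ^ ν with hσ
  have hv : 0 ≤ v ⬝ᵥ v := by simpa using dotProduct_star_self_nonneg v
  have hterm : ∀ i, (A (s i y)).quad ((D i x).mulVec v) ≤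
      (1 + ω * σ) * (A (s i y)).quad ((D i y).mulVec v) +
        (ω + ω ^ 2) * σ * (‖A‖ * (v ⬝ᵥ v)) := fun i => by
    -- With `t = ω σ` the error is `(1 + 1 / t) t² = t + t²`, linear in `σ` because `σ ≤ 1`.
    have h1 := SymMat.quad_add_le (hA.1 (s i y)) (mul_pos hω hσ0) ((D i y).mulVec v)
      ((D i x - D i y).mulVec v)
    rw [← Matrix.add_mulVec, add_sub_cancel] at h1
    have h2 : (A (s i y)).quad ((D i x - D i y).mulVec v) ≤
        ‖A‖ * ((ω * σ) ^ 2 * (v ⬝ᵥ v)) := by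
      have h3 := field_le_norm A (s i y) ((D i x - D i y).mulVec v)
      rw [SymMat.smul_quad, SymMat.one_quad] at h3
      refine h3.trans (mul_le_mul_of_nonneg_left ?_ (norm_nonneg _))
      refine (SymMat.dotProduct_self_mulVec_le _ v).trans (mul_le_mul_of_nonneg_right ?_ hv)
      have h4 := h.holder i x y
      rw [hsNorm] at h4
      exact (Real.sqrt_le_left (by positivity)).1 h4
    refine h1.trans (add_le_add le_rfl ?_)
    refine (mul_le_mul_of_nonneg_left h2 (by positivity)).trans ?_
    have h5 : (1 + 1 / (ω * σ)) * (‖A‖ * ((ω * σ) ^ 2 * (v ⬝ᵥ v))) =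
        (ω * σ + ω ^ 2 * σ * σ) * (‖A‖ * (v ⬝ᵥ v)) := by
      field_simp
      ring
    rw [h5]
    refine mul_le_mul_of_nonneg_right ?_ (by positivity)
    nlinarith [mul_pos (pow_pos hω 2) hσ0]
  have hlow : ‖A‖ * (v ⬝ᵥ v) ≤ Real.exp a / b ^ 2 * (transferOp s D A y).quad v := by
    have h1 := h.smul_one_le_transferOp hA y v
    rw [SymMat.smul_quad, SymMat.one_quad] at h1
    have h2 : ‖A‖ * (v ⬝ᵥ v) =
        Real.exp a / b ^ 2 * (Real.exp (-a) * b ^ 2 * ‖A‖ * (v ⬝ᵥ v)) := by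
      rw [Real.exp_neg]
      field_simp
    rw [h2]
    gcongr
  calc ∑ i, (A (s i y)).quad ((D i x).mulVec v)
      ≤ ∑ i, ((1 + ω * σ) * (A (s i y)).quad ((D i y).mulVec v) +
        (ω + ω ^ 2) * σ * (‖A‖ * (v ⬝ᵥ v))) := Finset.sum_le_sum fun i _ => hterm i
    _ = (1 + ω * σ) * (transferOp s D A y).quad v +
        n * ((ω + ω ^ 2) * σ * (‖A‖ * (v ⬝ᵥ v))) := by
        rw [Finset.sum_add_distrib, ← Finset.mul_sum, transferOp_quad]
        simp
    _ ≤ (1 + ω * σ) * (transferOp s D A y).quad v +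
        n * ((ω + ω ^ 2) * σ * (Real.exp a / b ^ 2 * (transferOp s D A y).quad v)) := by
        gcongr
    _ = _ := by ring

/-- Two losses add up to `imageConst`: moving the base point of `A` costs `e^{a r^ν σ}` since the `s
i` contract, and moving the argument of `D i` costs `1 + κσ ≤ e^{κσ}`. -/
theorem transferOp_mem_semiCone [Nonempty E] {A : C(E, SymMat d)} (hA : A ∈ semiCone E d a ν) :
    transferOp s D A ∈ semiCone E d (imageConst n r ν a b ω) ν := by
  refine ⟨transferOp_nonneg hA.1, fun x y v => ?_⟩
  have hω := h.ω_pos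
  have hb := h.b_pos
  have ha := h.a_pos
  have hσ0 : 0 ≤ dist x y ^ ν := by positivity
  have h1 : (transferOp s D A x).quad v ≤ Real.exp (a * r ^ ν * dist x y ^ ν) *
      ∑ i, (A (s i y)).quad ((D i x).mulVec v) := by
    rw [transferOp_quad, Finset.mul_sum]
    refine Finset.sum_le_sum fun i _ => ?_
    have h2 := hA.2 (s i x) (s i y) ((D i x).mulVec v)
    rw [SymMat.smul_quad] at h2
    have h3 : dist (s i x) (s i y) ^ ν ≤ r ^ ν * dist x y ^ ν := by
      rw [← Real.mul_rpow h.r_nonneg dist_nonneg]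
      exact Real.rpow_le_rpow dist_nonneg (h.contracting i x y) h.ν_pos.le
    have h4 : Real.exp (-(a * r ^ ν * dist x y ^ ν)) ≤
        Real.exp (-(a * dist (s i x) (s i y) ^ ν)) :=
      Real.exp_le_exp.2 (by nlinarith)
    have h5 := (mul_le_mul_of_nonneg_right h4
      (SymMat.nonneg_iff.1 (hA.1 (s i x)) ((D i x).mulVec v))).trans h2
    rwa [Real.exp_neg, inv_mul_le_iff₀ (Real.exp_pos _)] at h5
  have h6 := h.sum_quad_le hA (x := x) (y := y) v
  have h7 := SymMat.nonneg_iff.1 (transferOp_nonneg (s := s) (D := D) hA.1 y) v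
  set κ := ω + (ω + ω ^ 2) * (n * Real.exp a / b ^ 2) with hκ
  have h8 : 1 + κ * dist x y ^ ν ≤ Real.exp (κ * dist x y ^ ν) := by
    linarith [Real.add_one_le_exp (κ * dist x y ^ ν)]
  rw [SymMat.smul_quad, Real.exp_neg, inv_mul_le_iff₀ (Real.exp_pos _)]
  calc (transferOp s D A x).quad v
      ≤ Real.exp (a * r ^ ν * dist x y ^ ν) *
        (Real.exp (κ * dist x y ^ ν) * (transferOp s D A y).quad v) := by
        refine h1.trans (mul_le_mul_of_nonneg_left ?_ (Real.exp_pos _).le)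
        exact h6.trans (mul_le_mul_of_nonneg_right h8 h7)
    _ = _ := by
        rw [← mul_assoc, ← Real.exp_add, imageConst, ← hκ]
        ring_nf

omit [CompactSpace E] in
theorem imageConst_nonneg : 0 ≤ imageConst n r ν a b ω := by
  have hω := h.ω_pos
  have hb := h.b_pos
  have ha := h.a_pos
  have hr := h.r_nonneg
  rw [imageConst]
  positivity

omit [CompactSpace E] in
theorem imageConst_lt : imageConst n r ν a b ω < a := h.gap

/-- Let `a'` be the image constant. Subtracting `θk Id` from `L A` preserves the cone inequality if
`θk (1 - e^{-aσ}) Id ≤ (e^{-a'σ} - e^{-aσ}) (L A)_x`. The gap `a' < a` and the bound `L A ≥ k Id`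
leave room for this. -/
theorem lower_mem [Nonempty E] {A : C(E, SymMat d)} (hA : A ∈ semiCone E d a ν) :
    transferOp s D A - (Real.exp (-a) * b ^ 2 *
      (Real.exp (-a) * (a - imageConst n r ν a b ω) / a) * ‖A‖) • oneField E d ∈
        semiCone E d a ν := by
  have ha := h.a_pos
  have hb := h.b_pos
  have hgap := sub_pos.2 h.imageConst_lt
  have hnn := h.imageConst_nonneg
  have himg := h.transferOp_mem_semiCone hA
  set a' := imageConst n r ν a b ω
  set k := Real.exp (-a) * b ^ 2 * ‖A‖ with hk
  have hk0 : 0 ≤ k := by positivity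
  have hexp1 : Real.exp (-a) ≤ 1 := Real.exp_le_one_iff.2 (by linarith)
  -- Chosen so that `θ (1 - e^{-aσ}) ≤ θ a σ = e^{-a} (a - a') σ ≤ e^{-a'σ} - e^{-aσ}`.
  set θ := Real.exp (-a) * (a - a') / a with hθ
  have hθ0 : 0 ≤ θ := by positivity
  have hθ1 : θ ≤ 1 := by
    rw [hθ, div_le_one ha]
    nlinarith [Real.exp_pos (-a)]
  have hc : Real.exp (-a) * b ^ 2 * θ * ‖A‖ = θ * k := by rw [hk]; ring
  rw [hc]
  have hlow := h.smul_one_le_transferOp hA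
  refine ⟨fun x => sub_nonneg.2 (le_trans ?_ (hlow x)), fun x y v => ?_⟩
  · refine SymMat.smul_le_smul_of_le SymMat.one_nonneg ?_
    rw [← hk]
    nlinarith
  have hv : 0 ≤ v ⬝ᵥ v := by simpa using dotProduct_star_self_nonneg v
  have hσ0 : 0 ≤ dist x y ^ ν := by positivity
  have hσ1 := h.rpow_dist_le_one x y
  have h1 := himg.2 x y v
  have h2 := hlow x v
  set σ := dist x y ^ ν
  simp only [ContinuousMap.sub_apply, ContinuousMap.smul_apply, oneField_apply, SymMat.smul_quad,
    SymMat.sub_quad, SymMat.one_quad] at h1 h2 ⊢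
  have h3 : θ * (a * σ) ≤ Real.exp (-(a' * σ)) - Real.exp (-(a * σ)) := by
    have h4 : Real.exp (-(a' * σ)) = Real.exp (-(a * σ)) * Real.exp ((a - a') * σ) := by
      rw [← Real.exp_add]
      ring_nf
    have h5 := Real.add_one_le_exp ((a - a') * σ)
    have h6 : Real.exp (-a) ≤ Real.exp (-(a * σ)) := Real.exp_le_exp.2 (by nlinarith)
    have h7 : θ * (a * σ) = Real.exp (-a) * ((a - a') * σ) := by
      rw [hθ]
      field_simp
    rw [h7, h4]
    have h8 : 0 ≤ (a - a') * σ := by positivity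
    nlinarith [Real.exp_pos (-(a * σ))]
  have h9 : 1 - Real.exp (-(a * σ)) ≤ a * σ := by
    linarith [Real.add_one_le_exp (-(a * σ))]
  have h10 : θ * (1 - Real.exp (-(a * σ))) ≤ Real.exp (-(a' * σ)) - Real.exp (-(a * σ)) :=
    (mul_le_mul_of_nonneg_left h9 hθ0).trans h3
  have h11 : 0 ≤ Real.exp (-(a' * σ)) - Real.exp (-(a * σ)) := le_trans (by positivity) h3
  have h12 := mul_le_mul_of_nonneg_right h10 (mul_nonneg hk0 hv)
  have h13 := mul_le_mul_of_nonneg_left h2 h11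
  nlinarith

theorem mem_of_image [Nonempty E] {A : C(E, SymMat d)} (hA : A ∈ semiCone E d a ν) :
    transferOp s D A ∈ semiCone E d a ν := by
  have h1 := h.transferOp_mem_semiCone hA
  refine ⟨h1.1, fun x y => le_trans (SymMat.smul_le_smul_of_le (h1.1 x)
    (Real.exp_le_exp.2 ?_)) (h1.2 x y)⟩
  have h2 := h.imageConst_lt.le
  have h3 : 0 ≤ dist x y ^ ν := by positivity
  nlinarith

/-- The image lies in the cone, so its Hölder constant, like its norm, is at most a multiple of
`‖A‖`; a large multiple of the identity then dominates it in the order of the cone. -/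
theorem exists_upper_mem [Nonempty E] : ∃ C : ℝ, ∀ A ∈ semiCone E d a ν, ∀ C' ≥ C,
    (C' * ‖A‖) • oneField E d - transferOp s D A ∈ semiCone E d a ν := by
  have ha := h.a_pos
  set m := 3 * ‖transferOp s D (oneField E d)‖
  refine ⟨m + 3 * ‖SymMat.one d‖ * Real.exp a * m, fun A hA C' hC' => ?_⟩
  have h1 := norm_transferOp_le s D A
  have h2 := norm_sub_le_of_mem_semiCone ha.le (h.mem_of_image hA)
  refine smul_oneField_sub_mem ha h.dist_le_one h.ν_pos (by positivity) h2 ?_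
  calc ‖transferOp s D A‖ +
        3 * ‖SymMat.one d‖ * a * ‖transferOp s D A‖ * Real.exp a / a
      = (1 + 3 * ‖SymMat.one d‖ * Real.exp a) * ‖transferOp s D A‖ := by
        field_simp
    _ ≤ (1 + 3 * ‖SymMat.one d‖ * Real.exp a) * (m * ‖A‖) := by gcongr
    _ = (m + 3 * ‖SymMat.one d‖ * Real.exp a * m) * ‖A‖ := by ring
    _ ≤ C' * ‖A‖ := by gcongr

theorem exists_contractsCone [Nonempty E] [NeZero d] : ∃ c C : ℝ,
    ContractsCone (semiCone E d a ν) (transferOp s D) (oneField E d) c C 3 := by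
  obtain ⟨C, hC⟩ := h.exists_upper_mem
  have ha := h.a_pos
  have hb := h.b_pos
  have hgap := sub_pos.2 h.imageConst_lt
  refine ⟨Real.exp (-a) * b ^ 2 * (Real.exp (-a) * (a - imageConst n r ν a b ω) / a),
    max C (Real.exp (-a) * b ^ 2 * (Real.exp (-a) * (a - imageConst n r ν a b ω) / a)), ?_⟩
  exact
    { isClosed := isClosed_semiCone a ν
      add_mem := fun {A B} hA hB => ⟨fun x => add_nonneg (hA.1 x) (hB.1 x), fun x y => by
        simpa only [ContinuousMap.add_apply, smul_add] using add_le_add (hA.2 x y) (hB.2 x y)⟩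
      smul_mem := fun {t A} ht hA => ⟨fun x => smul_nonneg ht (hA.1 x), fun x y => by
        simpa only [ContinuousMap.smul_apply, smul_comm t] using
          smul_le_smul_of_nonneg_left (hA.2 x y) ht⟩
      normal := fun {A B} h1 h2 => norm_le_of_abs_le
        (fun x => neg_le_iff_add_nonneg.2 (by simpa [add_comm] using h2.1 x))
        (fun x => sub_nonneg.1 (h1.1 x))
      continuous := continuous_transferOp s D
      mem := ⟨fun x => SymMat.one_nonneg, fun x y => by
        have h1 : Real.exp (-(a * dist x y ^ ν)) ≤ 1 :=
          Real.exp_le_one_iff.2 (neg_nonpos.2 (by positivity))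
        simpa using SymMat.smul_le_smul_of_le SymMat.one_nonneg h1⟩
      -- The entry `(0, 0)` exists because `d ≠ 0`.
      ne_zero := fun h0 => by
        have h1 := congrArg (fun A : C(E, SymMat d) => (A (Classical.arbitrary E)).mat 0 0) h0
        simp [SymMat.one] at h1
      pos := by positivity
      le := le_max_right _ _
      lower := fun hA => h.lower_mem hA
      upper := fun hA => hC _ hA _ (le_max_left _ _) }

end TransferData

end Transfer

/-! ### Approximation by Hölder fields -/

section InfConvolution

variable {E : Type} [MetricSpace E]

/-- The inf-convolution of `f` with `k dist^ν`. -/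
def infConvolution (k ν : ℝ) (f : E → ℝ) (x : E) : ℝ := ⨅ y, (f y + k * dist x y ^ ν)

variable {k ν M : ℝ} {f : E → ℝ}

theorem bddBelow_infConvolution (hk : 0 ≤ k) (hf : ∀ x, |f x| ≤ M) (x : E) :
    BddBelow (range fun y => f y + k * dist x y ^ ν) := by
  refine ⟨-M, ?_⟩
  rintro _ ⟨y, rfl⟩
  have h1 : 0 ≤ k * dist x y ^ ν := by positivity
  have h2 := (abs_le.1 (hf y)).1
  simp only
  linarith

/-- An infimum of functions with the same Hölder bound keeps it; each `k dist(·, y)^ν` has this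
bound because `t ↦ t^ν` is subadditive for `ν ≤ 1`. -/
theorem abs_infConvolution_sub_le (hk : 0 ≤ k) (hν : 0 < ν) (hν1 : ν ≤ 1)
    (hf : ∀ x, |f x| ≤ M) (x y : E) :
    |infConvolution k ν f x - infConvolution k ν f y| ≤ k * dist x y ^ ν := by
  have key : ∀ x y, infConvolution k ν f x - k * dist x y ^ ν ≤ infConvolution k ν f y := by
    intro x y
    have : Nonempty E := ⟨x⟩
    refine le_ciInf fun z => ?_
    have h1 := ciInf_le (bddBelow_infConvolution (ν := ν) hk hf x) z
    have h2 : dist x z ^ ν ≤ dist x y ^ ν + dist y z ^ ν :=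
      (Real.rpow_le_rpow dist_nonneg (dist_triangle x y z) hν.le).trans
        (Real.rpow_add_le_add_rpow dist_nonneg dist_nonneg hν.le hν1)
    have h3 := mul_le_mul_of_nonneg_left h2 hk
    change infConvolution k ν f x ≤ _ at h1
    linarith
  have h1 := key x y
  have h2 := key y x
  rw [dist_comm y x] at h2
  exact abs_le.2 ⟨by linarith, by linarith⟩

/-- With `k = 2M / ε^ν` the penalty beyond distance `ε` is at least the largest possible oscillation
`2M`, so only points within `ε` can lower the value of `f`. -/
theorem abs_sub_infConvolution_le {ε w : ℝ} (hε : 0 < ε) (hν : 0 < ν) (hM : 0 ≤ M)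
    (hf : ∀ x, |f x| ≤ M) (hw : ∀ x y, dist x y ≤ ε → |f x - f y| ≤ w) (x : E) :
    |f x - infConvolution (2 * M / ε ^ ν) ν f x| ≤ w := by
  have hk : 0 ≤ 2 * M / ε ^ ν := by positivity
  have : Nonempty E := ⟨x⟩
  have hw0 : 0 ≤ w := (abs_nonneg _).trans (hw x x (by simpa using hε.le))
  have h1 : infConvolution (2 * M / ε ^ ν) ν f x ≤ f x := by
    have h2 := ciInf_le (bddBelow_infConvolution (ν := ν) hk hf x) x
    simpa [infConvolution, Real.zero_rpow hν.ne'] using h2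
  have h2 : f x - w ≤ infConvolution (2 * M / ε ^ ν) ν f x := by
    refine le_ciInf fun y => ?_
    rcases le_total (dist x y) ε with hxy | hxy
    · have h3 := (abs_le.1 (hw x y hxy)).2
      have h4 : 0 ≤ 2 * M / ε ^ ν * dist x y ^ ν := by positivity
      linarith
    · have h3 : ε ^ ν ≤ dist x y ^ ν := Real.rpow_le_rpow hε.le hxy hν.le
      have h4 : 2 * M / ε ^ ν * ε ^ ν = 2 * M :=
        div_mul_cancel₀ _ (Real.rpow_pos_of_pos hε ν).ne'
      have h5 := mul_le_mul_of_nonneg_left h3 hk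
      have h6 := (abs_le.1 (hf y)).1
      have h7 := (abs_le.1 (hf x)).2
      linarith
  exact abs_le.2 ⟨by linarith, by linarith⟩

theorem continuous_of_abs_sub_le (hν : 0 < ν) (hf : ∀ x y, |f x - f y| ≤ k * dist x y ^ ν) :
    Continuous f := by
  refine continuous_iff_continuousAt.2 fun y => tendsto_iff_dist_tendsto_zero.2 ?_
  refine squeeze_zero (fun _ => dist_nonneg) (fun x => hf x y) ?_
  have h1 : Continuous fun x : E => k * dist x y ^ ν := by
    have h2 : Continuous fun x : E => dist x y := by fun_prop
    exact (h2.rpow_const fun _ => Or.inr hν.le).const_mul k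
  simpa [Real.zero_rpow hν.ne'] using h1.tendsto y

variable {d : ℕ} [CompactSpace E]

/-- Regularize entry by entry; symmetry survives because transposed entries are the same function.
The Hölder constant is explicit in `ε` so that the scale can later vary with the iterate. -/
theorem exists_holder_approx (hν : 0 < ν) (hν1 : ν ≤ 1) (B : C(E, SymMat d)) {ε w : ℝ}
    (hε : 0 < ε) (hw0 : 0 ≤ w) (hw : ∀ x y, dist x y ≤ ε → ‖B x - B y‖ ≤ w) :
    ∃ B' : C(E, SymMat d), ‖B - B'‖ ≤ d * w ∧
      ∀ x y, ‖B' x - B' y‖ ≤ d * (2 * ‖B‖ / ε ^ ν) * dist x y ^ ν := by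
  set k := 2 * ‖B‖ / ε ^ ν with hk
  have hk0 : 0 ≤ k := by positivity
  have hf : ∀ (i j : Fin d) (x : E), |(B x).mat i j| ≤ ‖B‖ := fun i j x =>
    ((B x).abs_entry_le_norm i j).trans (B.norm_coe_le_norm x)
  have hhol := fun i j : Fin d => abs_infConvolution_sub_le hk0 hν hν1 (hf i j)
  let B' : C(E, SymMat d) :=
    { toFun := fun x => SymMat.mk
        (Matrix.of fun i j => infConvolution k ν (fun z => (B z).mat i j) x) (by
          ext i j
          have h : (fun z => (B z).mat j i) = fun z => (B z).mat i j :=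
            funext fun z => (B z).isSymm.apply i j
          simp [h])
      continuous_toFun := SymMat.continuous_of_mat (continuous_matrix fun i j =>
        continuous_of_abs_sub_le hν (hhol i j)) }
  refine ⟨B', (ContinuousMap.norm_le _ (by positivity)).2 fun x => ?_, fun x y => ?_⟩
  · refine SymMat.norm_le_of_entry_le hw0 fun i j => ?_
    refine abs_sub_infConvolution_le hε hν (norm_nonneg B) (hf i j) (fun y z hyz => ?_) x
    exact ((B y - B z).abs_entry_le_norm i j).trans (hw y z hyz)
  · rw [mul_assoc]
    exact SymMat.norm_le_of_entry_le (by positivity) fun i j => hhol i j x y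

theorem exists_holder_norm_sub_le (hν : 0 < ν) (hν1 : ν ≤ 1) (B : C(E, SymMat d)) {ε : ℝ}
    (hε : 0 < ε) : ∃ B' : C(E, SymMat d), ‖B - B'‖ ≤ ε ∧
      ∃ H, 0 ≤ H ∧ ∀ x y, ‖B' x - B' y‖ ≤ H * dist x y ^ ν := by
  have hd : (0 : ℝ) < d + 1 := by positivity
  obtain ⟨δ, hδ, h⟩ := Metric.uniformContinuous_iff.1
    (CompactSpace.uniformContinuous_of_continuous B.continuous) (ε / (d + 1)) (by positivity)
  obtain ⟨B', h1, h2⟩ := exists_holder_approx hν hν1 B (half_pos hδ)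
    (w := ε / (d + 1)) (by positivity) (fun x y hxy => by
      rw [← dist_eq_norm]
      exact (h (by linarith)).le)
  refine ⟨B', h1.trans ?_, _, by positivity, h2⟩
  rw [mul_div_assoc', div_le_iff₀ hd]
  nlinarith

end InfConvolution

/-! ### Convergence of the iterates -/

section Convergence

variable {d n : ℕ} {E : Type} [MetricSpace E] [CompactSpace E]

/-- A positive eigenfunction `Q` of the transfer operator, with exponential convergence of the
normalized iterates of `ν`-Hölder fields to multiples of `Q`. -/
structure SpectralData (s : Fin n → C(E, E)) (D : Fin n → C(E, Matrix (Fin d) (Fin d) ℝ))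
    (ν β : ℝ) (Q : C(E, SymMat d)) (c K q : ℝ) : Prop where
  ν_pos : 0 < ν
  ν_le_one : ν ≤ 1
  β_pos : 0 < β
  eigen : transferOp s D Q = β • Q
  norm_eq_one : ‖Q‖ = 1
  c_pos : 0 < c
  lower : ∀ x, c • SymMat.one d ≤ Q x
  K_nonneg : 0 ≤ K
  q_pos : 0 < q
  q_lt_one : q < 1
  rate : ∀ (B : C(E, SymMat d)) (H : ℝ), 0 ≤ H →
    (∀ x y, ‖B x - B y‖ ≤ H * dist x y ^ ν) →
    ∃ t : ℝ, ∀ l : ℕ, ‖(β ^ l)⁻¹ • (transferOp s D ^ l) B - t • Q‖ ≤ K * (‖B‖ + H) * q ^ l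

/-- Since `Q = β⁻¹ L Q`, the strong lower bound gives `Q ≥ (c / β) Id` in the order of the cone.
Multiples of `Q` can thus replace those of the identity, and a Hölder field `B` lies between `±κ
(‖B‖ + H) Q`. -/
theorem TransferData.exists_spectralData [Nonempty E] [NeZero d] {s : Fin n → C(E, E)}
    {D : Fin n → C(E, Matrix (Fin d) (Fin d) ℝ)} {r ν a b ω : ℝ}
    (h : TransferData s D r ν a b ω) :
    ∃ (β : ℝ) (Q : C(E, SymMat d)) (c K q : ℝ),
      Q ∈ semiCone E d a ν ∧ SpectralData s D ν β Q c K q := by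
  obtain ⟨c, C, hK⟩ := h.exists_contractsCone
  obtain ⟨β, hβ, Q, hQK, hQ1, hQ⟩ := hK.exists_eigenvector
  have ha := h.a_pos
  have hc := hK.pos
  have hQc : Q - (c / β) • oneField E d ∈ semiCone E d a ν := by
    have h1 := hK.smul_mem (t := β⁻¹) (by positivity) (hK.lower hQK)
    rw [hQ, hQ1, smul_sub, smul_smul, inv_mul_cancel₀ hβ.ne', one_smul, smul_smul] at h1
    convert h1 using 3
    ring
  set κ := (1 + Real.exp a / a) / (c / β) with hκ
  have hκ0 : 0 ≤ κ := by positivity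
  -- The 6 is the normality constant 3 times the factor 2 in the length `2κ (‖B‖ + H)` of the
  -- initial interval.
  refine ⟨β, Q, c / β, 6 * κ, ContractsCone.rate c C, hQK, h.ν_pos, h.ν_le_one, hβ, hQ, hQ1,
    by positivity, fun x => sub_nonneg.1 (hQc.1 x), by positivity, hK.rate_pos,
    hK.rate_lt_one, fun B H hH hB => ?_⟩
  have hBH : 0 ≤ ‖B‖ + H := by positivity
  have hT : ‖B‖ + H * Real.exp a / a ≤ (1 + Real.exp a / a) * (‖B‖ + H) := by
    have h1 : 0 ≤ Real.exp a / a * ‖B‖ := by positivity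
    have h2 : H * Real.exp a / a = Real.exp a / a * H := by ring
    rw [h2]
    nlinarith
  have hQT : ∀ B' : C(E, SymMat d),
      ((1 + Real.exp a / a) * (‖B‖ + H)) • oneField E d - B' ∈ semiCone E d a ν →
      (κ * (‖B‖ + H)) • Q - B' ∈ semiCone E d a ν := fun B' hB' => by
    have h1 := hK.add_mem (hK.smul_mem (mul_nonneg hκ0 hBH) hQc) hB'
    convert h1 using 1
    have h2 : κ * (‖B‖ + H) * (c / β) = (1 + Real.exp a / a) * (‖B‖ + H) := by
      rw [hκ]
      field_simp
    rw [smul_sub, smul_smul, h2]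
    abel
  have h1 := hQT B (smul_oneField_sub_mem ha h.dist_le_one h.ν_pos hH hB hT)
  have h2 := hQT (-B) (smul_oneField_sub_mem ha h.dist_le_one h.ν_pos hH
    (fun x y => by
      rw [ContinuousMap.neg_apply, ContinuousMap.neg_apply, ← neg_sub', norm_neg]
      exact hB x y) (by rwa [norm_neg]))
  obtain ⟨t, ht⟩ := hK.exists_norm_sub_le hβ hQK hQ (v := B) (m := -(κ * (‖B‖ + H)))
    (M := κ * (‖B‖ + H)) (by linarith [mul_nonneg hκ0 hBH])
    (by
      convert h2 using 1
      module) h1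
  refine ⟨t, fun l => (ht l).trans (le_of_eq ?_)⟩
  rw [hQ1]
  ring

/-! ### The limit functional and the rates of convergence. -/

namespace SpectralData

variable {s : Fin n → C(E, E)} {D : Fin n → C(E, Matrix (Fin d) (Fin d) ℝ)} {ν β : ℝ}
  {Q : C(E, SymMat d)} {c K q : ℝ} (h : SpectralData s D ν β Q c K q)

/-- The normalized iterates `β^{-l} L^l`. -/
def iter (s : Fin n → C(E, E)) (D : Fin n → C(E, Matrix (Fin d) (Fin d) ℝ)) (β : ℝ) (l : ℕ) :
    Module.End ℝ C(E, SymMat d) := (β ^ l)⁻¹ • transferOp s D ^ l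

omit [CompactSpace E] in
theorem iter_apply (l : ℕ) (B : C(E, SymMat d)) :
    iter s D β l B = (β ^ l)⁻¹ • (transferOp s D ^ l) B := rfl

include h

theorem ne_zero : Q ≠ 0 := norm_ne_zero_iff.1 (by simp [h.norm_eq_one])

theorem iter_eigen (l : ℕ) : iter s D β l Q = Q := by
  rw [iter_apply, ContractsCone.pow_map_eigenvector h.eigen, smul_smul,
    inv_mul_cancel₀ (pow_pos h.β_pos l).ne', one_smul]

theorem iter_nonneg (l : ℕ) {B : C(E, SymMat d)} (hB : ∀ x, 0 ≤ B x) (x : E) :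
    0 ≤ iter s D β l B x := by
  have h1 : ∀ x, 0 ≤ (transferOp s D ^ l) B x := by
    induction l with
    | zero => simpa using hB
    | succ l ih =>
      rw [pow_succ', Module.End.mul_apply]
      exact transferOp_nonneg ih
  exact smul_nonneg (inv_nonneg.2 (pow_nonneg h.β_pos.le l)) (h1 x)

/-- The field `B` lies between `±(‖B‖ / c) Q`, and the positive iterates fix `Q`. -/
theorem norm_iter_le (l : ℕ) (B : C(E, SymMat d)) : ‖iter s D β l B‖ ≤ 3 / c * ‖B‖ := by
  have hc := h.c_pos
  have h0 : ∀ x, ‖B‖ • SymMat.one d ≤ (‖B‖ / c) • Q x := fun x => by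
    have h1 := smul_le_smul_of_nonneg_left (h.lower x) (a := ‖B‖ / c) (by positivity)
    rwa [smul_smul, div_mul_cancel₀ _ hc.ne'] at h1
  have h1 := h.iter_nonneg l (B := (‖B‖ / c) • Q - B)
    (fun x => sub_nonneg.2 ((field_le_norm B x).trans (h0 x)))
  have h2 := h.iter_nonneg l (B := B - (-((‖B‖ / c) • Q)))
    (fun x => sub_nonneg.2 ((neg_le_neg (h0 x)).trans (neg_norm_le_field B x)))
  rw [map_sub, map_smul, h.iter_eigen] at h1
  rw [map_sub, map_neg, map_smul, h.iter_eigen] at h2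
  have h3 := norm_le_of_abs_le (fun x => sub_nonneg.1 (h2 x)) (fun x => sub_nonneg.1 (h1 x))
  rw [norm_smul, h.norm_eq_one, Real.norm_of_nonneg (by positivity)] at h3
  refine h3.trans (le_of_eq (by ring))

theorem tendsto_iter_of_rate {B : C(E, SymMat d)} {t R : ℝ}
    (ht : ∀ l : ℕ, ‖iter s D β l B - t • Q‖ ≤ R * q ^ l) :
    Tendsto (fun l => iter s D β l B) atTop (𝓝 (t • Q)) := by
  refine tendsto_iff_norm_sub_tendsto_zero.2 (squeeze_zero (fun _ => norm_nonneg _) ht ?_)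
  simpa using (tendsto_pow_atTop_nhds_zero_of_lt_one h.q_pos.le h.q_lt_one).const_mul R

/-- Density of Hölder fields and the uniform bound on the iterates give a Cauchy sequence. Its limit
is approximated by multiples of `Q`, which form a closed line. -/
theorem exists_tendsto (B : C(E, SymMat d)) :
    ∃ t : ℝ, Tendsto (fun l => iter s D β l B) atTop (𝓝 (t • Q)) := by
  have hc := h.c_pos
  set k := 3 / c with hk
  have hk0 : 0 < k := by positivity
  have approx : ∀ ε > 0, ∃ (B' : C(E, SymMat d)) (t : ℝ), (∀ l, ‖iter s D β l B -
      iter s D β l B'‖ ≤ ε) ∧ Tendsto (fun l => iter s D β l B') atTop (𝓝 (t • Q)) := by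
    intro ε hε
    obtain ⟨B', h1, H, hH, h2⟩ := exists_holder_norm_sub_le h.ν_pos h.ν_le_one B
      (ε := ε / k) (by positivity)
    obtain ⟨t, ht⟩ := h.rate B' H hH h2
    refine ⟨B', t, fun l => ?_, h.tendsto_iter_of_rate ht⟩
    rw [← map_sub]
    refine (h.norm_iter_le l _).trans ?_
    calc k * ‖B - B'‖ ≤ k * (ε / k) := by gcongr
      _ = ε := by field_simp
  have hcauchy : CauchySeq fun l => iter s D β l B := by
    refine Metric.cauchySeq_iff'.2 fun ε hε => ?_
    obtain ⟨B', t, h1, h2⟩ := approx (ε / 4) (by positivity)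
    obtain ⟨l₀, hl₀⟩ := Metric.cauchySeq_iff'.1 h2.cauchySeq (ε / 4) (by positivity)
    refine ⟨l₀, fun l hl => ?_⟩
    have h3 := hl₀ l hl
    have h4 := h1 l
    have h5 := h1 l₀
    rw [← dist_eq_norm] at h4 h5
    rw [dist_comm] at h5
    have h6 := dist_triangle4 (iter s D β l B) (iter s D β l B') (iter s D β l₀ B')
      (iter s D β l₀ B)
    linarith
  obtain ⟨B₀, hB₀⟩ := cauchySeq_tendsto_of_complete hcauchy
  have hmem : B₀ ∈ closure (Submodule.span ℝ {Q} : Set C(E, SymMat d)) := by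
    refine Metric.mem_closure_iff.2 fun ε hε => ?_
    obtain ⟨B', t, h1, h2⟩ := approx (ε / 2) (by positivity)
    refine ⟨t • Q, Submodule.smul_mem _ _ (Submodule.mem_span_singleton_self Q), ?_⟩
    have h3 := le_of_tendsto (hB₀.dist h2) (Eventually.of_forall fun l => by
      rw [dist_eq_norm]
      exact h1 l)
    linarith
  rw [(Submodule.closed_of_finiteDimensional (Submodule.span ℝ {Q})).closure_eq] at hmem
  obtain ⟨t, rfl⟩ := Submodule.mem_span_singleton.1 hmem
  exact ⟨t, hB₀⟩

/-- The limit of the normalized iterates is given by a positive functional. -/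
theorem exists_functional : ∃ φ : C(E, SymMat d) →ₗ[ℝ] ℝ,
    (∀ B, Tendsto (fun l => iter s D β l B) atTop (𝓝 (φ B • Q))) ∧
    φ Q = 1 ∧ (∀ B, φ (transferOp s D B) = β * φ B) ∧ ∀ B, (∀ x, 0 ≤ B x) → 0 ≤ φ B := by
  choose φ hφ using h.exists_tendsto
  have huniq : ∀ {B t}, Tendsto (fun l => iter s D β l B) atTop (𝓝 (t • Q)) → φ B = t :=
    fun ht => smul_left_injective ℝ h.ne_zero (tendsto_nhds_unique (hφ _) ht)
  let Φ : C(E, SymMat d) →ₗ[ℝ] ℝ :=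
    { toFun := φ
      map_add' := fun A B => huniq (by
        simp only [map_add, add_smul]
        exact (hφ A).add (hφ B))
      map_smul' := fun t B => huniq (by
        simp only [map_smul, RingHom.id_apply, smul_eq_mul, mul_smul]
        exact (hφ B).const_smul t) }
  refine ⟨Φ, hφ, huniq ?_, fun B => huniq ?_, fun B hB => ?_⟩
  · simp only [h.iter_eigen, one_smul]
    exact tendsto_const_nhds
  · have h1 : ∀ l, iter s D β l (transferOp s D B) = β • iter s D β (l + 1) B := fun l => by
      rw [iter_apply, iter_apply, smul_smul, pow_succ (transferOp s D), Module.End.mul_apply,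
        pow_succ β, mul_inv_rev, ← mul_assoc, mul_inv_cancel₀ h.β_pos.ne', one_mul]
    simp only [h1, mul_smul]
    exact ((tendsto_add_atTop_iff_nat 1).2 (hφ B)).const_smul β
  -- A negative value would make `Q` both nonnegative and nonpositive, hence zero at a point where
  -- its norm is 1.
  · by_contra! hneg
    change φ B < 0 at hneg
    have hE : Nonempty E := by
      by_contra hE
      rw [not_nonempty_iff] at hE
      exact h.ne_zero (ContinuousMap.ext fun x => (hE.false x).elim)
    obtain ⟨x, hx⟩ := exists_norm_apply_eq Q
    have h1 : 0 ≤ φ B • Q x := by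
      have h2 : Tendsto (fun l => iter s D β l B x) atTop (𝓝 ((φ B • Q) x)) :=
        ((continuous_eval_const x).tendsto _).comp (hφ B)
      exact ge_of_tendsto' h2 fun l => h.iter_nonneg l hB x
    have h3 : Q x ≤ 0 := by
      have h4 := smul_le_smul_of_nonneg_left h1 (a := (-φ B)⁻¹)
        (inv_nonneg.2 (neg_nonneg.2 hneg.le))
      rw [smul_zero, smul_smul] at h4
      have h5 : (-φ B)⁻¹ * φ B = -1 := by
        rw [inv_neg, neg_mul, inv_mul_cancel₀ hneg.ne]
      rw [h5, neg_one_smul] at h4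
      exact neg_nonneg.1 h4
    have h6 : 0 ≤ Q x := (smul_nonneg h.c_pos.le SymMat.one_nonneg).trans (h.lower x)
    rw [le_antisymm h3 h6, norm_zero, h.norm_eq_one] at hx
    exact zero_ne_one hx

variable {φ : C(E, SymMat d) →ₗ[ℝ] ℝ}
  (hφ : ∀ B, Tendsto (fun l => iter s D β l B) atTop (𝓝 (φ B • Q)))
include hφ

theorem abs_functional_le (B : C(E, SymMat d)) : |φ B| ≤ 3 / c * ‖B‖ := by
  have h1 := le_of_tendsto (hφ B).norm (Eventually.of_forall fun l => h.norm_iter_le l B)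
  rwa [norm_smul, h.norm_eq_one, mul_one] at h1

/-- Exponential convergence for fields which are Hölder of a smaller exponent. -/
theorem exists_rate {ν' : ℝ} (hν' : 0 < ν') (hle : ν' ≤ ν) {H : ℝ} (hH : 0 ≤ H) :
    ∃ K' q' : ℝ, 0 < q' ∧ q' < 1 ∧ ∀ B : C(E, SymMat d),
      (∀ x y, ‖B x - B y‖ ≤ H * ‖B‖ * dist x y ^ ν') → ∀ l : ℕ,
        ‖iter s D β l B - φ B • Q‖ ≤ K' * q' ^ l * ‖B‖ := by
  have hν := h.ν_pos
  have hq := h.q_pos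
  have hc := h.c_pos
  have hK := h.K_nonneg
  -- Balance of two errors. At scale `p^l` the approximation error is of order `p^{ν' l}`, while the
  -- `ν`-Hölder constant grows like `p^{-ν l}`. Taking `p^ν = √q` leaves a factor `√q ^ l` of the
  -- rate `q^l`, and `√q ≤ p^{ν'}`.
  set ρ := √q with hρ
  have hρ0 : 0 < ρ := Real.sqrt_pos.2 hq
  have hρ1 : ρ < 1 := by
    rw [hρ, Real.sqrt_lt' one_pos]
    simpa using h.q_lt_one
  have hρq : ρ * ρ = q := Real.mul_self_sqrt hq.le
  set p := ρ ^ (1 / ν) with hp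
  have hp0 : 0 < p := Real.rpow_pos_of_pos hρ0 _
  have hp1 : p < 1 := Real.rpow_lt_one hρ0.le hρ1 (by positivity)
  have hpν : p ^ ν = ρ := by
    rw [hp, ← Real.rpow_mul hρ0.le, one_div, inv_mul_cancel₀ hν.ne', Real.rpow_one]
  have hρp : ρ ≤ p ^ ν' := by
    rw [← hpν]
    exact Real.rpow_le_rpow_of_exponent_ge hp0 hp1.le hle
  -- The first term counts `B - B'` twice: under the iterate and under `φ`. The second is the rate
  -- for the regularized field `B'`.
  refine ⟨2 * (3 / c) * (d * H) + K * (1 + d * H + 2 * d), p ^ ν', Real.rpow_pos_of_pos hp0 _,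
    Real.rpow_lt_one hp0.le hp1 hν', fun B hB l => ?_⟩
  set z := (p ^ ν') ^ l with hz
  have hz0 : 0 < z := pow_pos (Real.rpow_pos_of_pos hp0 _) l
  have hz1 : z ≤ 1 := pow_le_one₀ (Real.rpow_pos_of_pos hp0 _).le
    (Real.rpow_lt_one hp0.le hp1 hν').le
  have hpl : ∀ μ : ℝ, (p ^ l) ^ μ = (p ^ μ) ^ l := fun μ => by
    rw [← Real.rpow_natCast, ← Real.rpow_natCast, ← Real.rpow_mul hp0.le, ← Real.rpow_mul hp0.le,
      mul_comm]
  obtain ⟨B', h1, h2⟩ := exists_holder_approx hν h.ν_le_one B (ε := p ^ l) (pow_pos hp0 l)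
    (w := H * ‖B‖ * z) (by positivity) (fun x y hxy => by
      refine (hB x y).trans (mul_le_mul_of_nonneg_left ?_ (by positivity))
      rw [hz, ← hpl]
      exact Real.rpow_le_rpow dist_nonneg hxy hν'.le)
  rw [hpl, hpν] at h2
  have hρl : 0 < ρ ^ l := pow_pos hρ0 l
  obtain ⟨t, ht⟩ := h.rate B' _ (by positivity) h2
  have htφ : φ B' = t := smul_left_injective ℝ h.ne_zero
    (tendsto_nhds_unique (hφ B') (h.tendsto_iter_of_rate ht))
  have h3 := ht l
  rw [← htφ] at h3
  have hB' : ‖B'‖ ≤ (1 + d * H) * ‖B‖ := by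
    have h4 := norm_sub_norm_le B' B
    rw [norm_sub_rev] at h4
    have h5 : d * (H * ‖B‖ * z) ≤ d * H * ‖B‖ := by
      have : (0 : ℝ) ≤ d * H * ‖B‖ := by positivity
      nlinarith
    linarith
  have hρz : ρ ^ l ≤ z := pow_le_pow_left₀ hρ0.le hρp l
  have h6 : K * (‖B'‖ + d * (2 * ‖B‖ / ρ ^ l)) * q ^ l ≤ K * (1 + d * H + 2 * d) * z * ‖B‖ := by
    have h7 : q ^ l = ρ ^ l * ρ ^ l := by rw [← mul_pow, hρq]
    have h8 : ρ ^ l ≤ 1 := pow_le_one₀ hρ0.le hρ1.le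
    have h9 : ‖B'‖ * q ^ l ≤ (1 + d * H) * ‖B‖ * z := by
      rw [h7]
      have h10 : ρ ^ l * ρ ^ l ≤ z := by nlinarith
      gcongr
    have h11 : d * (2 * ‖B‖ / ρ ^ l) * q ^ l ≤ 2 * d * ‖B‖ * z := by
      have h12 : d * (2 * ‖B‖ / ρ ^ l) * q ^ l = 2 * d * ‖B‖ * ρ ^ l := by
        rw [h7]
        field_simp
      rw [h12]
      gcongr
    calc K * (‖B'‖ + d * (2 * ‖B‖ / ρ ^ l)) * q ^ l
        = K * (‖B'‖ * q ^ l + d * (2 * ‖B‖ / ρ ^ l) * q ^ l) := by ring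
      _ ≤ K * ((1 + d * H) * ‖B‖ * z + 2 * d * ‖B‖ * z) := by gcongr
      _ = _ := by ring
  have h13 := h.norm_iter_le l (B - B')
  have h14 := h.abs_functional_le hφ (B' - B)
  rw [norm_sub_rev] at h14
  have h15 : iter s D β l B - φ B • Q = iter s D β l (B - B') + (iter s D β l B' - φ B' • Q) +
      φ (B' - B) • Q := by
    rw [map_sub, map_sub, sub_smul]
    abel
  have h16 : 3 / c * ‖B - B'‖ ≤ 3 / c * (d * (H * ‖B‖ * z)) := by gcongr
  calc ‖iter s D β l B - φ B • Q‖
      ≤ ‖iter s D β l (B - B')‖ + ‖iter s D β l B' - φ B' • Q‖ + ‖φ (B' - B) • Q‖ := by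
        rw [h15]
        exact norm_add₃_le
    _ ≤ 3 / c * (d * (H * ‖B‖ * z)) + K * (1 + d * H + 2 * d) * z * ‖B‖ +
        3 / c * (d * (H * ‖B‖ * z)) := by
        refine add_le_add (add_le_add (h13.trans h16) (h3.trans h6)) ?_
        rw [norm_smul, h.norm_eq_one, mul_one]
        exact h14.trans h16
    _ = _ := by ring

end SpectralData

end Convergence

/-! ### Matrix-valued measures with positive semidefinite values -/

section Measures

namespace SymMat

variable {d : ℕ}

/-- The rank-one matrix `v ᵗv`. -/
def rankOne (v : Fin d → ℝ) : SymMat d :=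
  mk (Matrix.vecMulVec v v) (Matrix.IsSymm.ext fun i j => by
    simp [Matrix.vecMulVec_apply, mul_comm])

theorem inner_rankOne (v : Fin d → ℝ) (A : SymMat d) : inner ℝ (rankOne v) A = A.quad v := by
  rw [inner_eq, rankOne, mat_mk, Matrix.transpose_vecMulVec, Matrix.vecMulVec_mul,
    Matrix.trace_vecMulVec, quad, bil, Matrix.dotProduct_mulVec, dotProduct_comm]

theorem rankOne_nonneg (v : Fin d → ℝ) : 0 ≤ rankOne v := nonneg_iff.2 fun w => by
  have h : (rankOne v).quad w = (v ⬝ᵥ w) * (v ⬝ᵥ w) := by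
    rw [quad, bil, rankOne, mat_mk, Matrix.vecMulVec_mulVec]
    simp [dotProduct_comm w v]
  rw [h]
  exact mul_self_nonneg _

/-- Self-duality of the positive semidefinite cone: testing on rank-one matrices is enough. -/
theorem nonneg_of_inner_nonneg {A : SymMat d} (h : ∀ P, 0 ≤ P → 0 ≤ inner ℝ P A) : 0 ≤ A :=
  nonneg_iff.2 fun v => by simpa only [inner_rankOne] using h _ (rankOne_nonneg v)

theorem add_norm_smul_one_nonneg (A : SymMat d) : 0 ≤ A + ‖A‖ • one d := by
  have := A.neg_norm_smul_one_le
  rwa [neg_le_iff_add_nonneg] at this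

end SymMat

variable {d : ℕ} {E : Type} [MeasurableSpace E]

/-- Scalarization: pairing with a positive semidefinite matrix reduces matrix-valued measures to
ordinary finite ones. -/
theorem exists_measure_inner {τ : VectorMeasure E (SymMat d)}
    (hτ : ∀ S, MeasurableSet S → 0 ≤ τ S) {P : SymMat d} (hP : 0 ≤ P) :
    ∃ μ : Measure E, IsFiniteMeasure μ ∧ ∀ S, MeasurableSet S → μ.real S = inner ℝ P (τ S) := by
  let σ : SignedMeasure E := τ.mapRange ((innerSL ℝ P : SymMat d →L[ℝ] ℝ) : SymMat d →+ ℝ)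
    (innerSL ℝ P).continuous
  have hσ : ∀ S, σ S = inner ℝ P (τ S) := fun S => rfl
  have h0 : VectorMeasure.restrict 0 univ ≤ VectorMeasure.restrict σ univ := by
    rw [VectorMeasure.restrict_le_restrict_iff _ _ MeasurableSet.univ]
    intro S hS _
    rw [hσ]
    exact SymMat.inner_nonneg_of_nonneg hP (hτ S hS)
  refine ⟨σ.toMeasureOfZeroLE univ MeasurableSet.univ h0, inferInstance, fun S hS => ?_⟩
  rw [SignedMeasure.toMeasureOfZeroLE_real_apply _ h0 MeasurableSet.univ hS, univ_inter, hσ]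

/-- The trace measure dominates the variation, because the norm of a positive semidefinite matrix is
at most its trace. -/
theorem isFiniteMeasure_variation {τ : VectorMeasure E (SymMat d)}
    (hτ : ∀ S, MeasurableSet S → 0 ≤ τ S) : IsFiniteMeasure τ.variation := by
  obtain ⟨μ, hμ, h⟩ := exists_measure_inner hτ SymMat.one_nonneg
  refine isFiniteMeasure_of_le μ (VectorMeasure.variation_le_of_forall_enorm_le fun S hS => ?_)
  rw [← ofReal_norm, ← ENNReal.ofReal_toReal (measure_ne_top μ S)]
  refine ENNReal.ofReal_le_ofReal ?_
  change _ ≤ μ.real S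
  rw [h S hS, SymMat.inner_one]
  exact SymMat.norm_le_trace (hτ S hS)

/-- Clear for indicators, extended to bounded functions by dominated convergence on both sides. -/
theorem hsIntegral_smul_eq_integral {τ : VectorMeasure E (SymMat d)} [IsFiniteMeasure τ.variation]
    {P : SymMat d} {μ : Measure E} [IsFiniteMeasure μ]
    (hμ : ∀ S, MeasurableSet S → μ.real S = inner ℝ P (τ S)) {f : E → ℝ} {C : ℝ}
    (hf : StronglyMeasurable f) (hC : ∀ x, ‖f x‖ ≤ C) :
    hsIntegral (fun x => f x • P) τ = ∫ x, f x ∂μ := by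
  have hgint : ∀ g : SimpleFunc E ℝ, Integrable (fun x => g x • P) τ.variation := fun g =>
    (g.integrable_of_isFiniteMeasure).smul_const P
  have simple : ∀ g : SimpleFunc E ℝ, hsIntegral (fun x => g x • P) τ = ∫ x, g x ∂μ := by
    intro g
    induction g using SimpleFunc.induction with
    | const c hs =>
      rename_i S
      have h1 : (fun x => (SimpleFunc.piecewise S hs (SimpleFunc.const E c)
          (SimpleFunc.const E 0)) x • P) = S.indicator fun _ => c • P := by
        ext1 x
        by_cases hx : x ∈ S <;> simp [hx]
      have h2 : (fun x => (SimpleFunc.piecewise S hs (SimpleFunc.const E c)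
          (SimpleFunc.const E 0)) x) = S.indicator fun _ => c := by
        ext1 x
        by_cases hx : x ∈ S <;> simp [hx]
      rw [h1, h2, hsIntegral, VectorMeasure.integral_indicator_const _ hs,
        integral_indicator_const _ hs, hμ S hs, innerSL_apply_apply, inner_smul_left, smul_eq_mul,
        mul_comm]
      simp
    | add hdisj hf hg =>
      rename_i f g
      have h1 : (fun x => (f + g) x • P) = fun x => f x • P + g x • P := by
        ext1 x
        simp [add_smul]
      have h2 := VectorMeasure.integral_fun_add (B := innerSL ℝ) (hgint f) (hgint g)
      rw [h1]
      simp only [SimpleFunc.coe_add, Pi.add_apply]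
      rw [integral_add f.integrable_of_isFiniteMeasure g.integrable_of_isFiniteMeasure, ← hf, ← hg]
      exact h2
  have hC0 : ∀ x, 0 ≤ C := fun x => (norm_nonneg _).trans (hC x)
  have hlim : ∀ x, Tendsto (fun k => hf.approxBounded C k x) atTop (𝓝 (f x)) := fun x =>
    hf.tendsto_approxBounded_of_norm_le (hC x)
  have h1 : Tendsto (fun k => ∫ x, hf.approxBounded C k x ∂μ) atTop (𝓝 (∫ x, f x ∂μ)) := by
    refine tendsto_integral_of_dominated_convergence (fun _ => C)
      (fun k => (SimpleFunc.stronglyMeasurable _).aestronglyMeasurable) (integrable_const C)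
      (fun k => Eventually.of_forall fun x => hf.norm_approxBounded_le (hC0 x) k x)
      (Eventually.of_forall hlim)
  have h2 : Tendsto (fun k => hsIntegral (fun x => hf.approxBounded C k x • P) τ) atTop
      (𝓝 (hsIntegral (fun x => f x • P) τ)) := by
    refine VectorMeasure.tendsto_integral_of_dominated_convergence (fun _ => C * ‖P‖)
      (fun k => ((SimpleFunc.stronglyMeasurable _).smul_const P).aestronglyMeasurable)
      (integrable_const _) (fun k => Eventually.of_forall fun x => ?_)
      (Eventually.of_forall fun x => (hlim x).smul_const P)
    rw [norm_smul]
    exact mul_le_mul_of_nonneg_right (hf.norm_approxBounded_le (hC0 x) k x) (norm_nonneg _)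
  simp only [simple] at h2
  exact tendsto_nhds_unique h2 h1

/-! ### Duality between continuous fields and matrix-valued measures. -/

variable [MetricSpace E] [CompactSpace E]

/-- The field `x ↦ f(x) P`. -/
def smulField (f : C(E, ℝ)) (P : SymMat d) : C(E, SymMat d) :=
  ⟨fun x => f x • P, f.continuous.smul continuous_const⟩

omit [MeasurableSpace E] [CompactSpace E] in
-- Expanding in an orthonormal basis of `M^d`, and writing each basis matrix as a difference of
-- positive semidefinite ones, shows that the fields `f P` with `P ≥ 0` span.
theorem linearMap_ext_smulField {φ ψ : C(E, SymMat d) →ₗ[ℝ] ℝ}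
    (h : ∀ (f : C(E, ℝ)) (P : SymMat d), 0 ≤ P → φ (smulField f P) = ψ (smulField f P)) :
    φ = ψ := by
  have h1 : ∀ (f : C(E, ℝ)) (A : SymMat d), φ (smulField f A) = ψ (smulField f A) := fun f A => by
    have h2 : smulField f A = smulField f (A + ‖A‖ • SymMat.one d) -
        smulField f (‖A‖ • SymMat.one d) := by
      ext1 x
      simp [smulField]
    rw [h2, map_sub, map_sub, h _ _ A.add_norm_smul_one_nonneg,
      h _ _ (smul_nonneg (norm_nonneg _) SymMat.one_nonneg)]
  let e := stdOrthonormalBasis ℝ (SymMat d)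
  ext B
  let f : _ → C(E, ℝ) := fun k => ⟨fun x => inner ℝ (e k) (B x),
    continuous_const.inner B.continuous⟩
  have h3 : B = ∑ k, smulField (f k) (e k) := by
    ext1 x
    rw [ContinuousMap.sum_apply]
    exact (e.sum_repr' (B x)).symm
  rw [h3, map_sum, map_sum]
  exact Finset.sum_congr rfl fun k _ => h1 _ _

variable [BorelSpace E]

theorem integrable_field (τ : VectorMeasure E (SymMat d)) [IsFiniteMeasure τ.variation]
    (B : C(E, SymMat d)) : τ.Integrable B :=
  B.continuous.integrable_of_hasCompactSupport (HasCompactSupport.of_compactSpace B)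

/-- Integration against a matrix-valued measure of finite variation. -/
def hsIntegralL (τ : VectorMeasure E (SymMat d)) [IsFiniteMeasure τ.variation] :
    C(E, SymMat d) →ₗ[ℝ] ℝ where
  toFun B := hsIntegral B τ
  map_add' A B := VectorMeasure.integral_add (integrable_field τ A) (integrable_field τ B)
  map_smul' c _ := VectorMeasure.integral_smul _ _ _ c

theorem hsIntegralL_smulField {τ : VectorMeasure E (SymMat d)} [IsFiniteMeasure τ.variation]
    {P : SymMat d} {μ : Measure E} [IsFiniteMeasure μ]
    (hμ : ∀ S, MeasurableSet S → μ.real S = inner ℝ P (τ S)) (f : C(E, ℝ)) :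
    hsIntegralL τ (smulField f P) = ∫ x, f x ∂μ :=
  hsIntegral_smul_eq_integral hμ f.continuous.stronglyMeasurable f.norm_coe_le_norm

omit [CompactSpace E] in
theorem measure_eq_of_integral_eq {μ μ' : Measure E} [IsFiniteMeasure μ]
    [IsFiniteMeasure μ'] (h : ∀ f : C(E, ℝ), ∫ x, f x ∂μ = ∫ x, f x ∂μ') : μ = μ' :=
  ext_of_forall_integral_eq_of_IsFiniteMeasure fun f => h f.toContinuousMap

theorem vectorMeasure_eq_of_hsIntegral_eq {τ τ' : VectorMeasure E (SymMat d)}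
    (hτ : ∀ S, MeasurableSet S → 0 ≤ τ S) (hτ' : ∀ S, MeasurableSet S → 0 ≤ τ' S)
    (h : ∀ B : C(E, SymMat d), hsIntegral B τ = hsIntegral B τ') : τ = τ' := by
  have := isFiniteMeasure_variation hτ
  have := isFiniteMeasure_variation hτ'
  have h1 : ∀ S, MeasurableSet S → ∀ P, 0 ≤ P → inner ℝ P (τ S) = inner ℝ P (τ' S) := by
    intro S hS P hP
    obtain ⟨μ, _, hμ⟩ := exists_measure_inner hτ hP
    obtain ⟨μ', _, hμ'⟩ := exists_measure_inner hτ' hP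
    have h2 : μ = μ' := measure_eq_of_integral_eq fun f => by
      rw [← hsIntegralL_smulField hμ, ← hsIntegralL_smulField hμ']
      exact h _
    rw [← hμ S hS, ← hμ' S hS, h2]
  refine VectorMeasure.ext fun S hS => SymMat.ext_quad fun v => ?_
  rw [← SymMat.inner_rankOne, ← SymMat.inner_rankOne]
  exact h1 S hS _ (SymMat.rankOne_nonneg v)

open CompactlySupported in
-- The scalar Riesz-Markov-Kakutani theorem applied to the positive functional `f ↦ φ(f P)`.
theorem exists_measure_integral_eq {φ : C(E, SymMat d) →ₗ[ℝ] ℝ}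
    (hφ : ∀ B, (∀ x, 0 ≤ B x) → 0 ≤ φ B) {P : SymMat d} (hP : 0 ≤ P) :
    ∃ μ : Measure E, IsFiniteMeasure μ ∧ ∀ f : C(E, ℝ), ∫ x, f x ∂μ = φ (smulField f P) := by
  let Λ₀ : C_c(E, ℝ) →ₗ[ℝ] ℝ :=
    { toFun := fun f => φ (smulField f.toContinuousMap P)
      map_add' := fun f g => by
        rw [← map_add]
        congr 1
        ext1 x
        exact add_smul (f x) (g x) P
      map_smul' := fun c f => by
        rw [← map_smul]
        congr 1
        ext1 x
        exact mul_smul c (f x) P }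
  let Λ : C_c(E, ℝ) →ₚ[ℝ] ℝ := PositiveLinearMap.mk₀ Λ₀ fun f hf =>
    hφ _ fun x => smul_nonneg (hf x) hP
  refine ⟨RealRMK.rieszMeasure Λ, inferInstance, fun f => ?_⟩
  exact RealRMK.integral_rieszMeasure Λ
    (CompactlySupportedContinuousMap.continuousMapEquiv f)

/-- Riesz representation of the positive functionals on fields of symmetric matrices. -/
theorem exists_vectorMeasure_hsIntegral_eq {φ : C(E, SymMat d) →ₗ[ℝ] ℝ}
    (hφ : ∀ B, (∀ x, 0 ≤ B x) → 0 ≤ φ B) :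
    ∃ τ : VectorMeasure E (SymMat d), (∀ S, MeasurableSet S → 0 ≤ τ S) ∧
      ∀ B : C(E, SymMat d), hsIntegral B τ = φ B := by
  choose! m hfin hm using fun P (hP : (0 : SymMat d) ≤ P) => exists_measure_integral_eq hφ hP
  have hone := SymMat.one_nonneg (d := d)
  have hadd : ∀ {P R : SymMat d}, 0 ≤ P → 0 ≤ R → ∀ S,
      (m (P + R)).real S = (m P).real S + (m R).real S := fun {P R} hP hR S => by
    have := hfin P hP
    have := hfin R hR
    have := hfin (P + R) (add_nonneg hP hR)
    have h1 : m (P + R) = m P + m R := measure_eq_of_integral_eq fun f => by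
      have hf : ∀ μ : Measure E, IsFiniteMeasure μ → Integrable f μ := fun μ _ =>
        f.continuous.integrable_of_hasCompactSupport (HasCompactSupport.of_compactSpace f)
      rw [integral_add_measure (hf _ inferInstance) (hf _ inferInstance), hm P hP, hm R hR,
        hm _ (add_nonneg hP hR), ← map_add]
      congr 1
      ext1 x
      exact smul_add (f x) P R
    rw [h1, measureReal_add_apply]
  have hsmul : ∀ {t : ℝ} {P : SymMat d}, 0 ≤ t → 0 ≤ P → ∀ S,
      (m (t • P)).real S = t * (m P).real S := fun {t P} ht hP S => by
    have := hfin P hP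
    have := hfin (t • P) (smul_nonneg ht hP)
    lift t to ℝ≥0 using ht
    have h1 : m ((t : ℝ) • P) = t • m P := measure_eq_of_integral_eq fun f => by
      rw [integral_smul_nnreal_measure, hm P hP, hm _ (smul_nonneg t.coe_nonneg hP),
        NNReal.smul_def, ← map_smul]
      congr 1
      ext1 x
      exact smul_comm (f x) (t : ℝ) P
    rw [h1, measureReal_nnreal_smul_apply]
  -- For fixed `S`, this extends `P ↦ m P S` from the positive semidefinite cone to all of `M^d`. By
  -- additivity the value does not depend on how `A` is written as a difference, which gives
  -- linearity.
  let ℓ : Set E → SymMat d → ℝ := fun S A =>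
    (m (A + ‖A‖ • SymMat.one d)).real S - (m (‖A‖ • SymMat.one d)).real S
  have hnorm : ∀ A : SymMat d, 0 ≤ ‖A‖ • SymMat.one d := fun A =>
    smul_nonneg (norm_nonneg A) hone
  have hℓ : ∀ (S : Set E) {A P R : SymMat d}, 0 ≤ P → 0 ≤ R → A = P - R →
      ℓ S A = (m P).real S - (m R).real S := fun S {A P R} hP hR hA => by
    have h1 : A + ‖A‖ • SymMat.one d + R = P + ‖A‖ • SymMat.one d := by
      nth_rw 1 [hA]
      abel
    have h2 := hadd A.add_norm_smul_one_nonneg hR S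
    rw [h1, hadd hP (hnorm A)] at h2
    simp only [ℓ]
    linarith
  have hlin : ∀ S, IsLinearMap ℝ (ℓ S) := fun S =>
    { map_add := fun A B => by
        rw [hℓ S (add_nonneg A.add_norm_smul_one_nonneg B.add_norm_smul_one_nonneg)
          (add_nonneg (hnorm A) (hnorm B)) (by abel),
          hadd A.add_norm_smul_one_nonneg B.add_norm_smul_one_nonneg, hadd (hnorm A) (hnorm B)]
        simp only [ℓ]
        ring
      map_smul := fun t A => by
        rcases le_total 0 t with ht | ht
        · rw [hℓ S (smul_nonneg ht A.add_norm_smul_one_nonneg) (smul_nonneg ht (hnorm A))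
            (by rw [smul_add, add_sub_cancel_right]), hsmul ht A.add_norm_smul_one_nonneg,
            hsmul ht (hnorm A), smul_eq_mul]
          simp only [ℓ]
          ring
        · have ht' : 0 ≤ -t := neg_nonneg.2 ht
          rw [hℓ S (smul_nonneg ht' (hnorm A)) (smul_nonneg ht' A.add_norm_smul_one_nonneg)
            (by module), hsmul ht' A.add_norm_smul_one_nonneg, hsmul ht' (hnorm A), smul_eq_mul]
          simp only [ℓ]
          ring }
  have hℓP : ∀ S {P : SymMat d}, 0 ≤ P → ℓ S P = (m P).real S := fun S {P} hP => by
    have h0 := hsmul (t := 0) (P := 0) le_rfl le_rfl S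
    rw [zero_smul, zero_mul] at h0
    rw [hℓ S hP le_rfl (sub_zero P).symm, h0, sub_zero]
  let e := stdOrthonormalBasis ℝ (SymMat d)
  have hf1 : ∀ k, IsFiniteMeasure (m (e k + ‖e k‖ • SymMat.one d)) := fun k =>
    hfin _ (e k).add_norm_smul_one_nonneg
  have hf2 : ∀ k, IsFiniteMeasure (m (‖e k‖ • SymMat.one d)) := fun k => hfin _ (hnorm _)
  let σ : _ → SignedMeasure E := fun k => (m (e k + ‖e k‖ • SymMat.one d)).toSignedMeasure -
    (m (‖e k‖ • SymMat.one d)).toSignedMeasure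
  -- The matrix `τ S` represents the linear form `ℓ S` for the Hilbert-Schmidt product.
  let τ : VectorMeasure E (SymMat d) := ∑ k, (σ k).mapRange
    ((ContinuousLinearMap.toSpanSingleton ℝ (e k) : ℝ →L[ℝ] SymMat d) : ℝ →+ SymMat d)
    (ContinuousLinearMap.toSpanSingleton ℝ (e k)).continuous
  have hτS : ∀ S, MeasurableSet S → τ S = ∑ k, ℓ S (e k) • e k := fun S hS => by
    have h1 : ∀ k, σ k S = ℓ S (e k) := fun k => by
      simp only [σ, ℓ]
      rw [sub_apply, Measure.toSignedMeasure_apply_measurable hS,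
        Measure.toSignedMeasure_apply_measurable hS]
    simp only [τ]
    rw [sum_apply]
    refine Finset.sum_congr rfl fun k _ => ?_
    rw [← h1]
    rfl
  have hinner : ∀ P : SymMat d, 0 ≤ P → ∀ S, MeasurableSet S →
      (m P).real S = inner ℝ P (τ S) := fun P hP S hS => by
    have h1 : ∀ A, ℓ S A = IsLinearMap.mk' (ℓ S) (hlin S) A := fun A => rfl
    rw [hτS S hS, inner_sum, ← hℓP S hP, h1]
    nth_rw 1 [← e.sum_repr' P]
    rw [map_sum]
    refine Finset.sum_congr rfl fun k _ => ?_
    rw [map_smul, inner_smul_right, ← h1, smul_eq_mul, real_inner_comm, mul_comm]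
  have hτ : ∀ S, MeasurableSet S → 0 ≤ τ S := fun S hS =>
    SymMat.nonneg_of_inner_nonneg fun P hP => by
      rw [← hinner P hP S hS]
      exact measureReal_nonneg
  have := isFiniteMeasure_variation hτ
  refine ⟨τ, hτ, fun B => ?_⟩
  have h1 : hsIntegralL τ = φ := linearMap_ext_smulField fun f P hP => by
    have := hfin P hP
    rw [hsIntegralL_smulField (hinner P hP), hm P hP]
  rw [← h1]
  rfl

end Measures

/-! ### The Ruelle-Perron-Frobenius theorem for transfer operators -/

section RuellePerronFrobenius

variable {d n : ℕ} {E : Type} [MetricSpace E] [CompactSpace E]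

/-! ### Simplicity, the affine case, and uniqueness of the eigenmeasure. -/

namespace SpectralData

variable {s : Fin n → C(E, E)} {D : Fin n → C(E, Matrix (Fin d) (Fin d) ℝ)} {ν β : ℝ}
  {Q : C(E, SymMat d)} {c K q : ℝ} (h : SpectralData s D ν β Q c K q)
include h

theorem posDef (x : E) : (Q x).mat.PosDef := SymMat.posDef_iff.2 fun v hv => by
  have h1 := h.lower x v
  rw [SymMat.smul_quad, SymMat.one_quad] at h1
  have h2 : 0 < v ⬝ᵥ v := lt_of_le_of_ne (by simpa using dotProduct_star_self_nonneg v)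
    fun h0 => hv (dotProduct_self_eq_zero.1 h0.symm)
  exact (mul_pos h.c_pos h2).trans_le h1

theorem hasEigenvector : (transferOp s D).HasEigenvector β Q :=
  ⟨Module.End.mem_eigenspace_iff.2 h.eigen, h.ne_zero⟩

variable {φ : C(E, SymMat d) →ₗ[ℝ] ℝ}
  (hφ : ∀ B, Tendsto (fun l => iter s D β l B) atTop (𝓝 (φ B • Q)))
include hφ

theorem eq_smul_of_eigen {B : C(E, SymMat d)} (hB : transferOp s D B = β • B) :
    B = φ B • Q := by
  have h1 : ∀ l, iter s D β l B = B := fun l => by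
    rw [iter_apply, ContractsCone.pow_map_eigenvector hB, smul_smul,
      inv_mul_cancel₀ (pow_pos h.β_pos l).ne', one_smul]
  have h2 := hφ B
  simp only [h1] at h2
  exact tendsto_nhds_unique tendsto_const_nhds h2

/-- By induction on the order, a generalized eigenvector satisfies `(L - β) B = t Q`. The functional
`φ` kills the left side and is 1 at `Q`, so `t = 0`, and eigenvectors are multiples of `Q`. -/
theorem maxGenEigenspace_eq (hφQ : φ Q = 1) (hφL : ∀ B, φ (transferOp s D B) = β * φ B) :
    (transferOp s D).maxGenEigenspace β = Submodule.span ℝ {Q} := by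
  refine le_antisymm (fun B hB => ?_) ?_
  · obtain ⟨k, hk⟩ := (Module.End.mem_maxGenEigenspace _ _ _).1 hB
    clear hB
    induction k generalizing B with
    | zero =>
      rw [pow_zero, Module.End.one_apply] at hk
      rw [hk]
      exact Submodule.zero_mem _
    | succ k ih =>
      rw [pow_succ, Module.End.mul_apply] at hk
      obtain ⟨t, ht⟩ := Submodule.mem_span_singleton.1 (ih _ hk)
      simp only [LinearMap.sub_apply, LinearMap.smul_apply, Module.End.one_apply] at ht
      have h1 := congrArg φ ht
      rw [map_smul, map_sub, map_smul, hφL, hφQ, smul_eq_mul, smul_eq_mul, mul_one, sub_self] at h1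
      rw [h1, zero_smul] at ht
      rw [h.eq_smul_of_eigen hφ (sub_eq_zero.1 ht.symm)]
      exact Submodule.smul_mem _ _ (Submodule.mem_span_singleton_self Q)
  · rw [Submodule.span_singleton_le_iff_mem]
    exact (Module.End.mem_maxGenEigenspace _ _ _).2 ⟨1, by simp [h.eigen]⟩

/-- With constant `D i` the operator preserves constant fields, so the limit `φ(Id) Q` of the
iterates of the identity is constant. As `‖Q‖ = 1` gives `Q ≤ Id`, one has `φ(Id) ≥ 1`. -/
theorem exists_eq_const [Nonempty E] (hφQ : φ Q = 1) (hφpos : ∀ B, (∀ x, 0 ≤ B x) → 0 ≤ φ B)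
    (hD : ∀ i x y, D i x = D i y) : ∃ Q' : SymMat d, ∀ x, Q x = Q' := by
  have hconst : ∀ l x y, (transferOp s D ^ l) (oneField E d) x =
      (transferOp s D ^ l) (oneField E d) y := by
    intro l
    induction l with
    | zero => intro x y; rfl
    | succ l ih =>
      intro x y
      rw [pow_succ', Module.End.mul_apply]
      refine SymMat.ext_quad fun v => ?_
      rw [transferOp_quad, transferOp_quad]
      exact Finset.sum_congr rfl fun i _ => by rw [hD i x y, ih (s i x) (s i y)]
  have hone : 1 ≤ φ (oneField E d) := by
    have h1 := hφpos (oneField E d - Q) fun x => sub_nonneg.2 (by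
      simpa [h.norm_eq_one] using field_le_norm Q x)
    rw [map_sub, hφQ] at h1
    linarith
  refine ⟨Q (Classical.arbitrary E), fun x => ?_⟩
  have hlim : ∀ x, Tendsto (fun l => iter s D β l (oneField E d) x) atTop
      (𝓝 (φ (oneField E d) • Q x)) := fun x =>
    ((continuous_eval_const x).tendsto _).comp (hφ (oneField E d))
  have h1 : ∀ l y, iter s D β l (oneField E d) x = iter s D β l (oneField E d) y := fun l y => by
    rw [iter_apply, ContinuousMap.smul_apply, ContinuousMap.smul_apply, hconst l x y]
  have h2 := hlim x
  simp only [h1 _ (Classical.arbitrary E)] at h2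
  have hne : φ (oneField E d) ≠ 0 := (one_pos.trans_le hone).ne'
  exact smul_right_injective _ hne (tendsto_nhds_unique h2 (hlim (Classical.arbitrary E)))

/-- An eigenmeasure gives `B` and `β^{-l} L^l B` the same integral. The latter fields tend uniformly
to `φ(B) Q`, and `Q` has integral 1. -/
theorem hsIntegral_eq_of_isAdjointImage [MeasurableSpace E] [BorelSpace E]
    {τ : VectorMeasure E (SymMat d)} (hτ : τ ∈ PQ Q)
    (hadj : IsAdjointImage (transferOp s D) τ (β • τ)) (B : C(E, SymMat d)) :
    hsIntegral B τ = φ B := by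
  have := isFiniteMeasure_variation fun S hS => SymMat.posSemidef_iff.1 (hτ.1 S hS)
  have hcont : Continuous (hsIntegralL τ) :=
    ((hsIntegralL τ).mkContinuous (‖(innerSL ℝ : SymMat d →L[ℝ] SymMat d →L[ℝ] ℝ)‖ *
      τ.variation.real univ) fun B => by
        refine (VectorMeasure.norm_integral_le_of_norm_le_const
          (Eventually.of_forall B.norm_coe_le_norm)).trans (le_of_eq (by ring))).continuous
  have hL : ∀ A, hsIntegralL τ (transferOp s D A) = β * hsIntegralL τ A := fun A => by
    refine (hadj A).symm.trans ?_
    exact VectorMeasure.integral_smul_vectorMeasure _ _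
  have hpow : ∀ l, hsIntegralL τ ((transferOp s D ^ l) B) = β ^ l * hsIntegralL τ B := fun l => by
    induction l with
    | zero => simp
    | succ l ih => rw [pow_succ', Module.End.mul_apply, hL, ih, pow_succ']; ring
  have hiter : ∀ l, hsIntegralL τ (iter s D β l B) = hsIntegralL τ B := fun l => by
    rw [iter_apply, map_smul, hpow, smul_eq_mul, ← mul_assoc,
      inv_mul_cancel₀ (pow_pos h.β_pos l).ne', one_mul]
  have h1 := (hcont.tendsto _).comp (hφ B)
  simp only [Function.comp_def, hiter] at h1
  have h2 := tendsto_nhds_unique tendsto_const_nhds h1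
  have h3 : hsIntegralL τ Q = 1 := hτ.2
  rw [map_smul, h3, smul_eq_mul, mul_one] at h2
  exact h2

end SpectralData

theorem TransferData.ruellePerronFrobenius [Nonempty E] [NeZero d] [MeasurableSpace E]
    [BorelSpace E] {s : Fin n → C(E, E)} {D : Fin n → C(E, Matrix (Fin d) (Fin d) ℝ)}
    {r ν a b ω : ℝ} (h : TransferData s D r ν a b ω) {aff : Prop}
    (haff : aff → ∀ i x y, D i x = D i y) :
    RuellePerronFrobenius (transferOp s D) dist a ν aff := by
  obtain ⟨β, Q, c, K, q, hQ, hS⟩ := h.exists_spectralData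
  obtain ⟨φ, hφ, hφQ, hφL, hφpos⟩ := hS.exists_functional
  obtain ⟨τ, hτ, hτφ⟩ := exists_vectorMeasure_hsIntegral_eq hφpos
  refine ⟨β, hS.β_pos, Q, mem_holderCone_iff.2 ⟨hS.posDef, hQ⟩, hS.hasEigenvector,
    hS.maxGenEigenspace_eq hφ hφQ hφL, fun ha => hS.exists_eq_const hφ hφQ hφpos (haff ha), τ,
    ⟨fun S hS => SymMat.posSemidef_iff.2 (hτ S hS), by rw [hτφ, hφQ]⟩, fun A => ?_,
    fun τ' hτ' hadj => ?_, fun B => ?_, fun ν' hν' hle a' ha' => ?_⟩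
  · rw [hτφ, hφL, ← hτφ]
    exact VectorMeasure.integral_smul_vectorMeasure _ _
  · refine vectorMeasure_eq_of_hsIntegral_eq
      (fun S hS => SymMat.posSemidef_iff.1 (hτ'.1 S hS)) hτ fun B => ?_
    rw [hτφ, hS.hsIntegral_eq_of_isAdjointImage hφ hτ' hadj]
  · rw [hτφ]
    exact hφ B
  · obtain ⟨K', q', hq0, hq1, hrate⟩ := hS.exists_rate hφ hν' hle
      (H := 3 * ‖SymMat.one d‖ * a') (by positivity)
    refine ⟨K', q', hq0, hq1, fun B hB l => ?_⟩
    rw [hτφ]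
    exact hrate B (norm_sub_le_of_mem_semiCone ha'.le (mem_holderCone_iff.1 hB).2) l

end RuellePerronFrobenius

/-! ### Distances between sequences -/

section Sequences

variable {n : ℕ} {γ : ℝ}

theorem seqDist_self (x : ℕ → Fin n) : seqDist γ x x = 0 := if_pos rfl

theorem seqDist_comm (x y : ℕ → Fin n) : seqDist γ x y = seqDist γ y x := by
  rcases eq_or_ne x y with rfl | h
  · rfl
  · simp only [seqDist, if_neg h, if_neg h.symm, ne_comm]

theorem exists_seqDist_eq {x y : ℕ → Fin n} (h : x ≠ y) :
    ∃ k, seqDist γ x y = γ ^ k ∧ (∀ i < k, x i = y i) ∧ x k ≠ y k := by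
  have hne : {k : ℕ | x k ≠ y k}.Nonempty := Function.ne_iff.1 h
  refine ⟨sInf {k : ℕ | x k ≠ y k}, if_neg h, fun i hi => ?_, Nat.sInf_mem hne⟩
  simpa using Nat.notMem_of_lt_sInf hi

theorem eq_of_seqDist_eq_zero (hγ : 0 < γ) (x y : ℕ → Fin n) (h : seqDist γ x y = 0) : x = y := by
  by_contra hne
  obtain ⟨k, hk, -⟩ := exists_seqDist_eq (γ := γ) hne
  exact (pow_pos hγ k).ne' (hk.symm.trans h)

theorem seqDist_le_pow (hγ : 0 < γ) (hγ1 : γ < 1) {x y : ℕ → Fin n} {k : ℕ}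
    (h : ∀ i < k, x i = y i) : seqDist γ x y ≤ γ ^ k := by
  rcases eq_or_ne x y with rfl | hne
  · rw [seqDist_self]
    positivity
  obtain ⟨m, hm, -, hm'⟩ := exists_seqDist_eq (γ := γ) hne
  rw [hm]
  refine pow_le_pow_of_le_one hγ.le hγ1.le ?_
  by_contra! hlt
  exact hm' (h m hlt)

theorem eq_of_seqDist_lt (hγ : 0 < γ) (hγ1 : γ < 1) {x y : ℕ → Fin n} {k : ℕ}
    (h : seqDist γ x y < γ ^ k) : ∀ i < k, x i = y i := by
  rcases eq_or_ne x y with rfl | hne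
  · exact fun _ _ => rfl
  obtain ⟨m, hm, hm', -⟩ := exists_seqDist_eq (γ := γ) hne
  rw [hm] at h
  exact fun i hi => hm' i (hi.trans ((pow_lt_pow_iff_right_of_lt_one₀ hγ hγ1).1 h))

/-- The distance is in fact an ultrametric: agreement of `x, y` up to `k` and of `y, z` up to `m`
gives agreement of `x, z` up to `min k m`. -/
theorem seqDist_triangle (hγ : 0 < γ) (hγ1 : γ < 1) (x y z : ℕ → Fin n) :
    seqDist γ x z ≤ seqDist γ x y + seqDist γ y z := by
  rcases eq_or_ne x y with rfl | hxy
  · simp [seqDist_self]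
  rcases eq_or_ne y z with rfl | hyz
  · simp [seqDist_self]
  obtain ⟨k, hk, hk', -⟩ := exists_seqDist_eq (γ := γ) hxy
  obtain ⟨m, hm, hm', -⟩ := exists_seqDist_eq (γ := γ) hyz
  have h1 : seqDist γ x z ≤ γ ^ min k m := seqDist_le_pow hγ hγ1 fun i hi =>
    (hk' i (hi.trans_le (min_le_left k m))).trans (hm' i (hi.trans_le (min_le_right k m)))
  rw [hk, hm]
  have h2 := pow_pos hγ k
  have h3 := pow_pos hγ m
  rcases min_choice k m with h4 | h4 <;> rw [h4] at h1 <;> linarith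

theorem seqDist_le_one (hγ : 0 < γ) (hγ1 : γ < 1) (x y : ℕ → Fin n) : seqDist γ x y ≤ 1 := by
  simpa using seqDist_le_pow hγ hγ1 (k := 0) (x := x) (y := y) (by simp)

theorem seqDist_consSeq_le (hγ : 0 < γ) (hγ1 : γ < 1) (i : Fin n) (x y : ℕ → Fin n) :
    seqDist γ (consSeq i x) (consSeq i y) ≤ γ * seqDist γ x y := by
  rcases eq_or_ne x y with rfl | hxy
  · simp [seqDist_self]
  obtain ⟨k, hk, hk', -⟩ := exists_seqDist_eq (γ := γ) hxy
  rw [hk, ← pow_succ']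
  refine seqDist_le_pow hγ hγ1 fun j hj => ?_
  cases j with
  | zero => rfl
  | succ j => exact hk' j (by omega)

/-- Balls correspond to cylinders. This lets `d_γ` be installed as a metric on the existing product
topology, so that the continuous fields and Borel sets are unchanged. -/
theorem isOpen_iff_seqDist (hγ : 0 < γ) (hγ1 : γ < 1) (s : Set (ℕ → Fin n)) :
    IsOpen s ↔ ∀ x ∈ s, ∃ ε > 0, ∀ y, seqDist γ x y < ε → y ∈ s := by
  refine ⟨fun hs x hx => ?_, fun h => isOpen_iff_forall_mem_open.2 fun x hx => ?_⟩
  · obtain ⟨_, ⟨z, k, rfl⟩, hxz, hsub⟩ :=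
      (PiNat.isTopologicalBasis_cylinders fun _ : ℕ => Fin n).exists_subset_of_mem_open hx hs
    refine ⟨γ ^ k, pow_pos hγ k, fun y hy => hsub fun i hi => ?_⟩
    rw [← eq_of_seqDist_lt hγ hγ1 hy i hi]
    exact hxz i hi
  · obtain ⟨ε, hε, hy⟩ := h x hx
    obtain ⟨k, hk⟩ := exists_pow_lt_of_lt_one hε hγ1
    refine ⟨PiNat.cylinder x k, fun y hyx => hy y (lt_of_le_of_lt ?_ hk),
      PiNat.isOpen_cylinder _ x k, PiNat.self_mem_cylinder x k⟩
    exact seqDist_le_pow hγ hγ1 fun i hi => (hyx i hi).symm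

/-- The metric `d_γ` on the space of sequences. -/
abbrev seqMetricSpace (n : ℕ) (hγ : 0 < γ) (hγ1 : γ < 1) : MetricSpace (ℕ → Fin n) :=
  MetricSpace.ofDistTopology (seqDist γ) seqDist_self seqDist_comm (seqDist_triangle hγ hγ1)
    (isOpen_iff_seqDist hγ hγ1) (eq_of_seqDist_eq_zero hγ)

end Sequences

/-! ### The Ruelle operators of an iterated function system -/

namespace ContractiveIFS

variable {d n : ℕ} (S : ContractiveIFS d n)

theorem dotProduct_jacobian_mulVec (f : Eucl d → Eucl d) (x : Eucl d) (v w : Fin d → ℝ) :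
    w ⬝ᵥ (jacobian f x).mulVec v =
      inner ℝ (fderiv ℝ f x (WithLp.toLp 2 v)) (WithLp.toLp 2 w) := by
  have h1 : WithLp.toLp 2 v = ∑ j, v j • (EuclideanSpace.single j 1 : Eucl d) := by
    ext i
    simp [Finset.sum_apply, Pi.single_apply]
  have h2 : (jacobian f x).mulVec v = fderiv ℝ f x (WithLp.toLp 2 v) := by
    ext i
    rw [h1, map_sum]
    simp [jacobian, Matrix.mulVec, dotProduct, mul_comm]
  rw [h2, PiLp.inner_apply]
  simp [dotProduct]

theorem jacobian_eq_of_isAffine (h : S.IsAffine) (i : Fin n) (x y : Eucl d) :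
    jacobian (S.ψ i) x = jacobian (S.ψ i) y := by
  obtain ⟨f, hf⟩ := h i
  have h1 : ∀ x, fderiv ℝ (S.ψ i) x = LinearMap.toContinuousLinearMap f.linear := fun x => by
    have h2 : S.ψ i = fun z => LinearMap.toContinuousLinearMap f.linear z + f 0 := by
      ext1 z
      exact (hf z).trans (congrFun f.decomp z)
    rw [h2]
    exact ((LinearMap.toContinuousLinearMap f.linear).hasFDerivAt.add_const (f 0)).fderiv
  simp only [jacobian, h1]

variable [NeZero n]

theorem nondegenerate_of_ND {b : ℝ} (hb : 0 < b) (h : S.ND b) {x : Eucl d} (hx : x ∈ S.G)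
    (v w : Fin d → ℝ) : ∃ i,
      b ^ 2 * (v ⬝ᵥ v) * (w ⬝ᵥ w) ≤ (w ⬝ᵥ (jacobian (S.ψ i) x).mulVec v) ^ 2 := by
  obtain ⟨i, hi⟩ := h x hx (WithLp.toLp 2 v) (WithLp.toLp 2 w)
  refine ⟨i, ?_⟩
  have h1 : ∀ v : Fin d → ℝ, v ⬝ᵥ v = ‖(WithLp.toLp 2 v : Eucl d)‖ ^ 2 := fun v => by
    rw [EuclideanSpace.real_norm_sq_eq]
    simp [dotProduct, sq]
  rw [dotProduct_jacobian_mulVec, ← sq_abs (inner ℝ _ _), h1, h1, ← mul_pow, ← mul_pow]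
  exact pow_le_pow_left₀ (by positivity) hi 2

/-- Sequences that agree on their first `k` symbols are coded in a common cell of diameter at most
`η^k ≤ γ^k`. This carries the Hölder bound on `Dψ_i` from `G` to the sequences. -/
theorem dist_Φ_le {γ : ℝ} (hγ : (S.η : ℝ) < γ) (hdiam : Metric.diam S.G ≤ 1)
    (x y : ℕ → Fin n) : dist (S.Φ x) (S.Φ y) ≤ seqDist γ x y := by
  rcases eq_or_ne x y with rfl | hxy
  · simp [seqDist_self]
  obtain ⟨k, hk, hk', -⟩ := exists_seqDist_eq (γ := γ) hxy
  have h1 : S.Φ y ∈ S.cell x k := by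
    have h2 := S.Φ_mem_cell y k
    rwa [cell, S.word_congr fun i hi => (hk' i hi).symm] at h2
  rw [hk]
  calc dist (S.Φ x) (S.Φ y) ≤ (S.η : ℝ) ^ k * Metric.diam S.G :=
        S.dist_le_of_mem_cell (S.Φ_mem_cell x k) h1
    _ ≤ γ ^ k * 1 := by
        exact mul_le_mul (pow_le_pow_left₀ S.η.2 hγ.le k) hdiam Metric.diam_nonneg
          (pow_nonneg (S.η.2.trans hγ.le) k)
    _ = γ ^ k := mul_one _

theorem Φ_mem_G (x : ℕ → Fin n) : S.Φ x ∈ S.G := by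
  obtain ⟨y, hy, h⟩ := S.Φ_mem_cell x 0
  rw [← h]
  exact hy

variable {a b ω : ℝ} (ha : 0 < a) (hb : 0 < b) (hω : 0 < ω)
  (hND : S.ND b) (hdiam : Metric.diam S.G ≤ 1) (hH : S.HolderSeminormLE ω)
include ha hb hω hND hdiam hH

theorem ruellePerronFrobenius_ruelleG [NeZero d]
    (hgap : a * (S.η : ℝ) ^ S.ν₀ + (ω + (ω + ω ^ 2) * (n * Real.exp a / b ^ 2)) < a) :
    RuellePerronFrobenius S.ruelleG dist a S.ν₀ S.IsAffine := by
  have : Nonempty S.G := S.nonempty_G.to_subtype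
  unfold ruelleG
  refine TransferData.ruellePerronFrobenius (r := S.η) (b := b) (ω := ω) ?_
    fun h i x y => S.jacobian_eq_of_isAffine h i x y
  refine ⟨S.η.2, S.ν₀_pos, S.ν₀_le_one, ha, hb, hω, fun x y => ?_, fun i x y => ?_,
    fun i x y => hH i x x.2 y y.2, fun x => S.nondegenerate_of_ND hb hND x.2, hgap⟩
  · exact (Metric.dist_le_diam_of_mem S.isCompact_G.isBounded x.2 y.2).trans hdiam
  · exact (S.lipschitz i).dist_le_mul (x : Eucl d) y

theorem ruellePerronFrobenius_ruelleShift [NeZero d] {γ : ℝ} (hγ : (S.η : ℝ) < γ) (hγ1 : γ < 1)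
    (hgap : a * γ ^ S.ν₀ + (ω + (ω + ω ^ 2) * (n * Real.exp a / b ^ 2)) < a) :
    RuellePerronFrobenius S.ruelleShift (seqDist γ) a S.ν₀ S.IsAffine := by
  have hγ0 : 0 < γ := lt_of_le_of_lt S.η.2 hγ
  let _ := seqMetricSpace n hγ0 hγ1
  unfold ruelleShift
  refine TransferData.ruellePerronFrobenius (E := ℕ → Fin n) (r := γ) (b := b) (ω := ω) ?_
    fun h i x y => S.jacobian_eq_of_isAffine h i _ _
  refine ⟨hγ0.le, S.ν₀_pos, S.ν₀_le_one, ha, hb, hω, seqDist_le_one hγ0 hγ1,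
    seqDist_consSeq_le hγ0 hγ1, fun i x y => ?_,
    fun x => S.nondegenerate_of_ND hb hND (S.Φ_mem_G x), hgap⟩
  exact (hH i _ (S.Φ_mem_G x) _ (S.Φ_mem_G y)).trans
    (mul_le_mul_of_nonneg_left (Real.rpow_le_rpow dist_nonneg (S.dist_Φ_le hγ hdiam x y)
      S.ν₀_pos.le) hω.le)

end ContractiveIFS

/-- For `ω ≤ 1` the left side is at most `ω (1 + 2R)`, which is 1 for the chosen `ω`. -/
theorem exists_holder_bound {R : ℝ} (hR : 0 ≤ R) :
    ∃ ω : ℝ, 0 < ω ∧ ω + (ω + ω ^ 2) * R ≤ 1 := by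
  refine ⟨1 / (1 + 2 * R), by positivity, ?_⟩
  have h1 : 1 / (1 + 2 * R) ≤ 1 := by
    rw [div_le_one (by positivity)]
    linarith
  have h2 : (0 : ℝ) < 1 / (1 + 2 * R) := by positivity
  have h3 : 1 / (1 + 2 * R) * (1 + 2 * R) = 1 := by field_simp
  set ω := 1 / (1 + 2 * R)
  nlinarith [mul_nonneg h2.le hR]

theorem lt_of_div_lt {a r ν κ : ℝ} (hr : 0 ≤ r) (hr1 : r < 1) (hν : 0 < ν) (hκ : κ ≤ 1)
    (h : 1 / (1 - r ^ ν) < a) : a * r ^ ν + κ < a := by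
  have h1 : r ^ ν < 1 := Real.rpow_lt_one hr hr1 hν
  rw [div_lt_iff₀ (by linarith)] at h
  linarith

end

theorem proposition4p5 (d n : ℕ) [NeZero d] [NeZero n] :
    ∃ a₀ : ℝ → ℝ → ℝ, ∀ a b : ℝ, 0 < a → 0 < b → ∃ ω : ℝ, 0 < ω ∧
      ∀ S : ContractiveIFS d n, S.F2 → S.F3 → S.F4 → S.ND b → Metric.diam S.G ≤ 1 →
        S.HolderSeminormLE ω →
        (a₀ S.ν₀ S.η < a →
          RuellePerronFrobenius S.ruelleG dist a S.ν₀ S.IsAffine) ∧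
        (∀ γ : ℝ, (S.η : ℝ) < γ → γ < 1 → a₀ S.ν₀ γ < a →
          RuellePerronFrobenius S.ruelleShift (seqDist γ) a S.ν₀ S.IsAffine) := by
  -- With this threshold `a (1 - r^ν) > 1`, so it suffices that the loss due to `ω` be at most 1;
  -- this makes `ω` independent of `ν` and `r`.
  refine ⟨fun ν r => 1 / (1 - r ^ ν), fun a b ha hb => ?_⟩
  obtain ⟨ω, hω, hκ⟩ := exists_holder_bound (R := n * Real.exp a / b ^ 2) (by positivity)
  refine ⟨ω, hω, fun S _ _ _ hND hdiam hH => ⟨fun hlt => ?_, fun γ hγ hγ1 hlt => ?_⟩⟩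
  · exact S.ruellePerronFrobenius_ruelleG ha hb hω hND hdiam hH
      (lt_of_div_lt S.η.2 S.η_lt_one S.ν₀_pos hκ hlt)
  · exact S.ruellePerronFrobenius_ruelleShift ha hb hω hND hdiam hH hγ hγ1
      (lt_of_div_lt (S.η.2.trans hγ.le) hγ1 S.ν₀_pos hκ hlt)
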